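/- Let $\operatorname{Im}\tau>0$, let $\theta_1(x)=\theta_1(x|\tau)=-\sum_{k\in\mathbb Z}\exp\bigl(\pi i\tau(k+\tfrac12)^2+2\pi i(x+\tfrac12)(k+\tfrac12)\bigr)$, let $\Lambda=\mathbb Z+\mathbb Z\tau$, let $\ell\ge1$ be an integer, $N=\tfrac12\ell(\ell+1)$, and let $\eta\in\mathbb C$ be such that $j\eta\notin\Lambda$ for $1\le j\le 2\ell$. Put $[j]=\theta_1(j\eta)/\theta_1(\eta)$, $[n]!=\prod_{j=1}^n[j]$, $\left[{n\atop m}\right]=\frac{[n]!}{[m]!\,[n-m]!}$ and $\Phi(x,\zeta)=\frac{\theta_1(\zeta+x)}{\theta_1(x)\theta_1(\zeta)}$. For $0\le s\le\ell$ let $$A_{\ell-s}(E)=\left[{\ell\atop s}\right]\left[{2\ell\atop s}\right]^{-1}\det\Bigl(E\delta_{i,j}+\tfrac{[-i]}{[\ell+1-i]}\delta_{i,j-1}+\tfrac{[2\ell+2-i]}{[\ell+1-i]}\delta_{i,j+1}\Bigr)_{1\le i,j\le s}.$$ The spectral curve $\Gamma$ of the difference Lamé operator is the set of $(\zeta,K,E)\in\mathbb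 C^3$ with $\zeta\notin\Lambda$, $K\neq0$ and $$\sum_{j=0}^{\ell}(-1)^jK^{-j}\theta_1(\zeta-j\eta)\left[{\ell\atop j}\right]A_j(E)=0,\qquad \sum_{j=0}^{\ell+1}(-1)^jK^{-j}\theta_1(\zeta-j\eta)[j-1]\left[{\ell+1\atop j}\right]A_{|j-1|}(E)=0 .$$ For $1\le m,n\le\ell$ let $$G_{mn}(\zeta)=(-1)^{\ell+1}\theta_1(2m\eta)\Bigl(\prod_{1\le j\le\ell,\;j\ne m}\frac{[m+j]}{[m-j]}\Bigr)\Phi\bigl(-(m+n)\eta,\zeta\bigr),$$ and for $0\le j\le N$ let $$C_j^{(\ell)}(\eta)=\sum_{J\subseteq\{1,\dots,\ell\},\ \sum_{k\in J}k=j}\ \ \prod_{k\in J}\ \prod_{k'\in\{1,\dots,\ell\}\setminus J}\frac{[k+k']}{[|k-k'|]} .$$ Then the following hold. (i) If $\Psi$ is entire, $E\in\mathbb C$, and $\frac{\theta_1(x-\ell\eta)}{\theta_1(x)}\Psi(x+\eta)+\frac{\theta_1(x+\ell\eta)}{\theta_1(x)}\Psi(x-\eta)=E\Psi(x)$ for all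 $x\notin\Lambda$, then $\Psi(j\eta)=\Psi(-j\eta)$ for $1\le j\le\ell$. (ii) The image of $\Gamma$ under $(\zeta,K,E)\mapsto(\zeta,K)$ is the set of all $(\zeta,K)$ with $\zeta\notin\Lambda$, $K\ne0$ and $$\det\bigl(K^{2m}\delta_{mn}+G_{mn}(\zeta)\bigr)_{1\le m,n\le\ell}=0 .$$ (iii) For $\zeta\notin\Lambda$ and $K\neq0$ this equation holds if and only if, for some $E\in\mathbb C$, the equation $$\psi(x+\eta)+\frac{\theta_1(x+\ell\eta)\theta_1(x-(\ell+1)\eta)}{\theta_1(x)\theta_1(x-\eta)}\psi(x-\eta)=E\psi(x)$$ has a solution $\psi(x)=K^{x/\eta}\sum_{j=1}^{\ell}s_j\Phi(x-j\eta,\zeta)$ with constants $s_1,\dots,s_\ell$ not all zero (the equation being imposed for all $x\notin\bigcup_{j=0}^{\ell+1}(j\eta+\Lambda)$). (iv) For $\zeta\notin\Lambda$ and all $K\in\mathbb C$, $$\theta_1(\zeta)\det\bigl(K^{2m}\delta_{mn}+G_{mn}(\zeta)\bigr)_{1\le m,n\le\ell}=\sum_{j=0}^{N}(-1)^jC_j^{(\ell)}(\eta)\,\theta_1(\zeta-2j\eta)\,K^{2(N-j)};$$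 in particular the determinant vanishes if and only if the sum on the right vanishes. (v) $C_0^{(\ell)}(\eta)=1$ and $C_j^{(\ell)}(\eta)=C_{N-j}^{(\ell)}(\eta)$ for $0\le j\le N$. -/

import Mathlib

noncomputable section

namespace DiffLame

/-- The odd Jacobi theta function
`θ₁(x|τ) = -∑_{k ∈ ℤ} exp(π i τ (k+1/2)² + 2 π i (x+1/2)(k+1/2))`. -/
def theta (τ x : ℂ) : ℂ :=
  -∑' k : ℤ, Complex.exp (Real.pi * Complex.I * τ * ((k : ℂ) + 1 / 2) ^ 2
    + 2 * Real.pi * Complex.I * (x + 1 / 2) * ((k : ℂ) + 1 / 2))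

/-- Membership in the period lattice `ℤ + ℤ τ`. -/
def InLattice (τ x : ℂ) : Prop := ∃ m n : ℤ, x = (m : ℂ) + (n : ℂ) * τ

/-- The elliptic number `[j] = θ₁(jη)/θ₁(η)`. -/
def enum (τ η : ℂ) (j : ℤ) : ℂ := theta τ ((j : ℂ) * η) / theta τ η

/-- The elliptic factorial `[n]! = [1][2]⋯[n]`. -/
def efact (τ η : ℂ) (n : ℕ) : ℂ := ∏ j ∈ Finset.Icc 1 n, enum τ η (j : ℤ)

/-- The elliptic binomial coefficient `[n]! / ([m]! [n-m]!)`, used for `m ≤ n`. -/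
def ebinom (τ η : ℂ) (n m : ℕ) : ℂ :=
  efact τ η n / (efact τ η m * efact τ η (n - m))

/-- The tridiagonal `s × s` matrix with entries, for `1 ≤ i, j ≤ s`,
`E δ_{i,j} + [-i]/[ℓ+1-i] δ_{i,j-1} + [2ℓ+2-i]/[ℓ+1-i] δ_{i,j+1}`. -/
def triMatrix (τ η : ℂ) (l : ℕ) (E : ℂ) (s : ℕ) : Matrix (Fin s) (Fin s) ℂ :=
  Matrix.of fun a b =>
    let i : ℤ := (a : ℤ) + 1
    let j : ℤ := (b : ℤ) + 1
    (if i = j then E else 0)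
      + (if i = j - 1 then enum τ η (-i) / enum τ η (l + 1 - i) else 0)
      + (if i = j + 1 then enum τ η (2 * l + 2 - i) / enum τ η (l + 1 - i) else 0)

/-- The polynomial (evaluated at `E`) `A_j^{(ℓ)}(E)`, for `0 ≤ j ≤ ℓ`. With `s = ℓ - j` it is
the elliptic binomial `ℓ` over `s`, divided by the elliptic binomial `2ℓ` over `s`, times the
determinant of the `s × s` tridiagonal matrix. -/
def polyA (τ η : ℂ) (l j : ℕ) (E : ℂ) : ℂ :=
  ebinom τ η l (l - j) / ebinom τ η (2 * l) (l - j) * (triMatrix τ η l E (l - j)).det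

/-- The spectral curve of the difference Lamé operator, as the set of points `(ζ, K, E)` with
`ζ ∉ ℤ + ℤ τ` and `K ≠ 0` that obey its two defining equations. -/
def spectralCurve (τ η : ℂ) (l : ℕ) : Set (ℂ × ℂ × ℂ) :=
  {p | ¬ InLattice τ p.1 ∧ p.2.1 ≠ 0 ∧
    (∑ j ∈ Finset.range (l + 1), (-1) ^ j * p.2.1⁻¹ ^ j * theta τ (p.1 - j * η)
        * ebinom τ η l j * polyA τ η l j p.2.2 = 0) ∧
    (∑ j ∈ Finset.range (l + 2), (-1) ^ j * p.2.1⁻¹ ^ j * theta τ (p.1 - j * η)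
        * enum τ η ((j : ℤ) - 1) * ebinom τ η (l + 1) j
        * polyA τ η l ((j : ℤ) - 1).natAbs p.2.2 = 0)}

/-- The function `Φ(x, ζ) = θ₁(ζ + x) / (θ₁(x) θ₁(ζ))`. -/
def Phi (τ x ζ : ℂ) : ℂ := theta τ (ζ + x) / (theta τ x * theta τ ζ)

/-- The double-Bloch ansatz `ψ(x) = K^{x/η} ∑_{j=1}^{ℓ} s_j Φ(x - jη, ζ)`. -/
def ansatz (τ η : ℂ) (l : ℕ) (ζ K : ℂ) (s : ℕ → ℂ) (x : ℂ) : ℂ :=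
  K ^ (x / η) * ∑ j ∈ Finset.Icc 1 l, s j * Phi τ (x - j * η) ζ

/-- The difference Lamé equation
`ψ(x+η) + θ₁(x+ℓη) θ₁(x-(ℓ+1)η) / (θ₁(x) θ₁(x-η)) ψ(x-η) = E ψ(x)` at the point `x`. -/
def LameEqAt (τ η : ℂ) (l : ℕ) (E : ℂ) (ψ : ℂ → ℂ) (x : ℂ) : Prop :=
  ψ (x + η) + theta τ (x + l * η) * theta τ (x - (l + 1) * η)
    / (theta τ x * theta τ (x - η)) * ψ (x - η) = E * ψ x

/-- There is a nontrivial double-Bloch solution of the difference Lamé equation with parameters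
`(ζ, K, E)`. The equation is imposed at every `x` outside the union of the lattice translates
`jη + ℤ + ℤ τ`, `0 ≤ j ≤ ℓ + 1`, which contain all the poles of its terms. -/
def HasDoubleBloch (τ η : ℂ) (l : ℕ) (ζ K E : ℂ) : Prop :=
  ∃ s : ℕ → ℂ, (∃ j ∈ Finset.Icc 1 l, s j ≠ 0) ∧
    ∀ x : ℂ, (∀ j ∈ Finset.range (l + 2), ¬ InLattice τ (x - j * η)) →
      LameEqAt τ η l E (ansatz τ η l ζ K s) x

/-- The entries, for `1 ≤ m, n ≤ ℓ`,
`G_{mn}(ζ) = (-1)^{ℓ+1} θ₁(2mη) (∏_{1 ≤ j ≤ ℓ, j ≠ m} [m+j]/[m-j]) Φ(-(m+n)η, ζ)`. -/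
def entryG (τ η : ℂ) (l : ℕ) (ζ : ℂ) (m n : ℕ) : ℂ :=
  (-1) ^ (l + 1) * theta τ (2 * m * η)
    * (∏ j ∈ (Finset.Icc 1 l).erase m,
        enum τ η ((m : ℤ) + j) / enum τ η ((m : ℤ) - j))
    * Phi τ (-((m + n) * η)) ζ

/-- The `ℓ × ℓ` matrix `(K^{2m} δ_{mn} + G_{mn}(ζ))_{1 ≤ m, n ≤ ℓ}`. -/
def multMatrix (τ η : ℂ) (l : ℕ) (ζ K : ℂ) : Matrix (Fin l) (Fin l) ℂ :=
  Matrix.of fun a b =>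
    (if a = b then K ^ (2 * ((a : ℕ) + 1)) else 0)
      + entryG τ η l ζ ((a : ℕ) + 1) ((b : ℕ) + 1)

/-- `C_j^{(ℓ)}(η)`: the sum over subsets `J ⊆ {1, …, ℓ}` with element sum `j` of
`∏_{k ∈ J, k' ∉ J} [k+k']/[|k-k'|]`. -/
def coeffC (τ η : ℂ) (l j : ℕ) : ℂ :=
  ∑ J ∈ (Finset.Icc 1 l).powerset with ∑ k ∈ J, k = j,
    ∏ k ∈ J, ∏ k' ∈ Finset.Icc 1 l \ J,
      enum τ η ((k : ℤ) + k') / enum τ η |(k : ℤ) - k'|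

/-- The number `N = ℓ(ℓ+1)/2`. -/
def bigN (l : ℕ) : ℕ := l * (l + 1) / 2

/-- The left-hand side `∑_{j=0}^{N} (-1)^j C_j θ₁(ζ - 2jη) K^{2(N-j)}` of the relation. -/
def relationSum (τ η : ℂ) (l : ℕ) (ζ K : ℂ) : ℂ :=
  ∑ j ∈ Finset.range (bigN l + 1),
    (-1) ^ j * coeffC τ η l j * theta τ (ζ - 2 * j * η) * K ^ (2 * (bigN l - j))

end DiffLame

end

noncomputable section

open Complex

namespace DiffLame

/-! ### Entire functions -/

/-! Clearing denominators, the ansatz is `K^{x/η}` times an entire function P (`psi`) over `θ(ζ) ∏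
θ(x - kη)`, and the Lamé equation becomes `K θ(x-ℓη) P(x+η) + K⁻¹ θ(x+ℓη) P(x-η) = E θ(x) P(x)`
(`BlochEqAt`). P is a theta function of degree ℓ whose multiplier involves ζ, and its coefficients
are, up to nonzero factors, its values at η, …, ℓη. All terms of the equation have degree ℓ+1 and
the same multipliers. Since ζ ∉ Λ, such a function vanishes as soon as it vanishes at 0, η, …, ℓη
(`eq_zero_of_theta_multipliers`), so the equation amounts to ℓ+1 scalar conditions
(`diffEq_of_values`).

For fixed E, the conditions at η, …, ℓη are a three-term recurrence for `K^j P(jη)`, also satisfied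
by the polynomials `A_j(E)`. Solved downwards from j = ℓ, it gives `P(jη) = κ K^{-j} A_j(E)`.
Interpolating P from η, …, ℓη to 0 and to -η then yields the two equations of Γ
(`exists_blochEq_iff_curve`).

To eliminate E, note that every solution satisfies `K^{2j} P(jη) = P(-jη)` for 1 ≤ j ≤ ℓ, by
induction on j; the same induction proves (i). These conditions form a linear system whose matrix
is, up to scaling of rows, `multMatrix`. Conversely, on its solution space the left-hand side of the
equation is divisible by θ(x), and the quotient is again such a P with the same symmetry. The
difference operator thus acts on this space; if the space is nonzero, an eigenvector is a
double-Bloch solution and its eigenvalue is E (`exists_blochEq_iff`).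

The determinant of `diag(K^{2m}) + G` is a sum over principal minors of G. Each is an elliptic
Cauchy determinant with parameters kη, evaluated by Schur complements and Fay's identity
(`theta_fay`, `det_cauchyTheta`). Sorting the index sets by their element sum gives (iv), and
complementing them gives the symmetry in (v).

All this rests on θ having simple zeros exactly on Λ, which follows by comparing θ with an infinite
product and applying Liouville's theorem. -/

theorem exists_eq_mul_of_simple_zeros {F G : ℂ → ℂ} (hF : Differentiable ℂ F)
    (hG : Differentiable ℂ G) (h : ∀ p, G p = 0 → F p = 0 ∧ deriv G p ≠ 0) :
    ∃ H : ℂ → ℂ, Differentiable ℂ H ∧ ∀ x, F x = G x * H x := by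
  classical
  -- The value at a zero p of G is the limit of F/G: there F and G are `x - p` times their `dslope`
  -- at p, and that of G takes the value `G'(p) ≠ 0` at p.
  refine ⟨fun x => if G x = 0 then deriv F x / deriv G x else F x / G x, ?_, ?_⟩
  · intro p
    by_cases hp : G p = 0
    · obtain ⟨hFp, hG'⟩ := h p hp
      have dF : Differentiable ℂ (dslope F p) := by
        rw [← differentiableOn_univ, Complex.differentiableOn_dslope Filter.univ_mem]
        exact hF.differentiableOn
      have dG : Differentiable ℂ (dslope G p) := by
        rw [← differentiableOn_univ, Complex.differentiableOn_dslope Filter.univ_mem]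
        exact hG.differentiableOn
      have hne : dslope G p p ≠ 0 := by rwa [dslope_same]
      have hev : ∀ᶠ x in nhds p, dslope G p x ≠ 0 := dG.continuous.continuousAt.eventually_ne hne
      have key : (fun x => if G x = 0 then deriv F x / deriv G x else F x / G x)
          =ᶠ[nhds p] fun x => dslope F p x / dslope G p x := by
        filter_upwards [hev] with x hx
        by_cases hxp : x = p
        · subst hxp
          simp [hp]
        · have e1 : F x = (x - p) * dslope F p x := by
            have := sub_smul_dslope F p x
            rw [hFp, sub_zero, smul_eq_mul] at this
            exact this.symm
          have e2 : G x = (x - p) * dslope G p x := by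
            have := sub_smul_dslope G p x
            rw [hp, sub_zero, smul_eq_mul] at this
            exact this.symm
          have hxp' : x - p ≠ 0 := sub_ne_zero.2 hxp
          have : G x ≠ 0 := by rw [e2]; exact mul_ne_zero hxp' hx
          rw [if_neg this, e1, e2, mul_div_mul_left _ _ hxp']
      exact ((dF p).div (dG p) hne).congr_of_eventuallyEq key
    · have hev : ∀ᶠ x in nhds p, G x ≠ 0 := hG.continuous.continuousAt.eventually_ne hp
      refine ((hF p).div (hG p) hp).congr_of_eventuallyEq ?_
      filter_upwards [hev] with x hx
      simp [hx]
  · intro x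
    by_cases hx : G x = 0
    · simp [hx, (h x hx).1]
    · simp [hx, mul_div_cancel₀]

/-- The identity theorem in the form in which nonzero entire factors are cancelled: an identity
checked off the zeros of G extends to the whole plane. -/
theorem eq_zero_of_mul_eq_zero_of_differentiable {F G : ℂ → ℂ} (hF : Differentiable ℂ F)
    (hG : Differentiable ℂ G) (hne : ∃ x, G x ≠ 0) (h : ∀ x, G x * F x = 0) (x : ℂ) : F x = 0 := by
  obtain ⟨a, ha⟩ := hne
  have hev : ∀ᶠ x in nhds a, G x ≠ 0 := hG.continuous.continuousAt.eventually_ne ha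
  have hF' : AnalyticOnNhd ℂ F Set.univ := fun z _ => hF.analyticAt z
  have : F =ᶠ[nhds a] 0 := by
    filter_upwards [hev] with x hx
    exact (mul_eq_zero.1 (h x)).resolve_left hx
  exact congrFun (hF'.eq_of_eventuallyEq (g := 0) (fun z _ => analyticAt_const) this) x

/-- A continuous function whose absolute value is invariant under translation by `1` and `τ`
is bounded. -/
theorem bounded_of_norm_doubly_periodic {τ : ℂ} (hτ : 0 < τ.im) {F : ℂ → ℂ} (hF : Continuous F)
    (h1 : ∀ x, ‖F (x + 1)‖ = ‖F x‖) (h2 : ∀ x, ‖F (x + τ)‖ = ‖F x‖) :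
    Bornology.IsBounded (Set.range F) := by
  have p1 : ∀ (n : ℤ) x, ‖F (x + n)‖ = ‖F x‖ := by
    intro n x
    have : Function.Periodic (fun x => ‖F x‖) (1 : ℂ) := h1
    simpa using this.int_mul n x
  have p2 : ∀ (n : ℤ) x, ‖F (x + n * τ)‖ = ‖F x‖ := by
    intro n x
    have : Function.Periodic (fun x => ‖F x‖) τ := h2
    simpa using this.int_mul n x
  have hK : IsCompact ((fun p : ℝ × ℝ => (p.1 : ℂ) + p.2 * τ) '' (Set.Icc 0 1 ×ˢ Set.Icc 0 1)) :=
    (isCompact_Icc.prod isCompact_Icc).image (by fun_prop)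
  obtain ⟨r, hr⟩ := (hK.image hF).isBounded.subset_closedBall 0
  refine (Metric.isBounded_closedBall (x := (0 : ℂ)) (r := r)).subset ?_
  rintro _ ⟨x, rfl⟩
  obtain ⟨a, b, hab⟩ : ∃ a b : ℝ, x = a + b * τ := by
    refine ⟨(x - (x.im / τ.im : ℝ) * τ).re, x.im / τ.im, ?_⟩
    apply Complex.ext <;> simp [hτ.ne']
  have e : x = ((Int.fract a : ℝ) + (Int.fract b : ℝ) * τ) + (⌊b⌋ : ℂ) * τ + (⌊a⌋ : ℂ) := by
    have ha : (a : ℂ) = (⌊a⌋ : ℂ) + (Int.fract a : ℝ) := by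
      exact_mod_cast (Int.floor_add_fract a).symm
    have hb : (b : ℂ) = (⌊b⌋ : ℂ) + (Int.fract b : ℝ) := by
      exact_mod_cast (Int.floor_add_fract b).symm
    rw [hab]
    nth_rewrite 1 [ha]
    nth_rewrite 1 [hb]
    ring
  rw [mem_closedBall_zero_iff, e, p1, p2]
  refine mem_closedBall_zero_iff.1 (hr ⟨_, ⟨(Int.fract a, Int.fract b), ?_, rfl⟩, rfl⟩)
  exact ⟨⟨Int.fract_nonneg a, (Int.fract_lt_one a).le⟩, Int.fract_nonneg b,
    (Int.fract_lt_one b).le⟩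

theorem eq_of_doubly_periodic {τ : ℂ} (hτ : 0 < τ.im) {F : ℂ → ℂ} (hF : Differentiable ℂ F)
    (h1 : ∀ x, F (x + 1) = F x) (h2 : ∀ x, F (x + τ) = F x) (x y : ℂ) : F x = F y :=
  hF.apply_eq_apply_of_bounded (bounded_of_norm_doubly_periodic hτ hF.continuous
    (fun x => by rw [h1]) (fun x => by rw [h2])) x y

/-- This is the degree-zero case. An exponential factor makes both multipliers unimodular, so
Liouville makes the product constant; a nonzero constant would force both multipliers to be 1, which
puts ζ in the lattice. -/
theorem eq_zero_of_multipliers {τ ζ : ℂ} (hτ : 0 < τ.im) (hζ : ¬ InLattice τ ζ) {F : ℂ → ℂ}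
    (hF : Differentiable ℂ F) (h1 : ∀ x, F (x + 1) = F x)
    (h2 : ∀ x, F (x + τ) = exp (-(2 * Real.pi * I * ζ)) * F x) (x : ℂ) : F x = 0 := by
  -- This real a makes the real part `-a τ.im + 2π ζ.im` of `I a τ - 2πIζ` vanish.
  set a : ℝ := 2 * Real.pi * ζ.im / τ.im with ha
  have hc : Differentiable ℂ fun x => exp (I * a * x) * F x := by fun_prop
  have m1 : ∀ x, exp (I * a * (x + 1)) * F (x + 1) = exp (I * a) * (exp (I * a * x) * F x) := by
    intro x
    rw [h1, mul_add, mul_one, exp_add]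
    ring
  have m2 : ∀ x, exp (I * a * (x + τ)) * F (x + τ)
      = exp (I * a * τ - 2 * Real.pi * I * ζ) * (exp (I * a * x) * F x) := by
    intro x
    rw [h2, mul_add, exp_add, sub_eq_add_neg, exp_add]
    ring
  have n1 : ‖exp (I * a)‖ = 1 := by
    rw [mul_comm]; exact norm_exp_ofReal_mul_I a
  have n2 : ‖exp (I * a * τ - 2 * Real.pi * I * ζ)‖ = 1 := by
    rw [norm_exp, Real.exp_eq_one_iff]
    have : (2 * (Real.pi : ℂ) * I * ζ).re = - (2 * Real.pi * ζ.im) := by simp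
    rw [sub_re, this]
    have : (I * a * τ).re = - (a * τ.im) := by simp
    rw [this, ha]
    field_simp
    ring
  have hconst : ∀ x y, exp (I * a * x) * F x = exp (I * a * y) * F y := by
    refine hc.apply_eq_apply_of_bounded (bounded_of_norm_doubly_periodic hτ hc.continuous ?_ ?_)
    · intro x; simp only [m1, norm_mul, n1, one_mul]
    · intro x; simp only [m2, norm_mul, n2, one_mul]
  by_contra hx
  have hne : exp (I * a * x) * F x ≠ 0 := mul_ne_zero (exp_ne_zero _) hx
  have q1 : exp (I * a) = 1 := by
    have := m1 x
    rw [hconst (x + 1) x] at this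
    exact (mul_eq_right₀ hne).1 this.symm
  have q2 : exp (I * a * τ - 2 * Real.pi * I * ζ) = 1 := by
    have := m2 x
    rw [hconst (x + τ) x] at this
    exact (mul_eq_right₀ hne).1 this.symm
  obtain ⟨n, hn⟩ := exp_eq_one_iff.1 q1
  obtain ⟨m, hm⟩ := exp_eq_one_iff.1 q2
  refine hζ ⟨-m, n, ?_⟩
  rw [hn] at hm
  have h0 : (2 * Real.pi * I : ℂ) ≠ 0 := two_pi_I_ne_zero
  apply mul_left_cancel₀ h0
  push_cast
  linear_combination -hm

/-! ### The infinite product `∏ (1 - Qⁿ w)` -/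

/-- The infinite product `∏_{n ≥ 0} (1 - Qⁿ w)`. -/
def qProd (Q w : ℂ) : ℂ := ∏' n : ℕ, (1 - Q ^ n * w)

theorem summable_qProd {Q : ℂ} (hQ : ‖Q‖ < 1) (w : ℂ) : Summable fun n : ℕ => ‖-(Q ^ n * w)‖ := by
  simp only [norm_neg, norm_mul, norm_pow]
  exact (summable_geometric_of_lt_one (norm_nonneg _) hQ).mul_right _

theorem multipliable_qProd {Q : ℂ} (hQ : ‖Q‖ < 1) (w : ℂ) :
    Multipliable fun n : ℕ => 1 - Q ^ n * w := by
  simp only [sub_eq_add_neg]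
  exact multipliable_one_add_of_summable (summable_qProd hQ w)

theorem qProd_eq_mul {Q : ℂ} (hQ : ‖Q‖ < 1) (w : ℂ) :
    qProd Q w = (1 - w) * qProd Q (Q * w) := by
  have hm : Multipliable fun n : ℕ => 1 - Q ^ (n + 1) * w := by
    simpa only [pow_succ, mul_assoc] using multipliable_qProd hQ (Q * w)
  have h := tprod_eq_zero_mul' (f := fun n : ℕ => 1 - Q ^ n * w) hm
  simp only [pow_succ, mul_assoc, pow_zero, one_mul] at h
  exact h

theorem qProd_ne_zero {Q : ℂ} (hQ : ‖Q‖ < 1) {w : ℂ} (h : ∀ n : ℕ, Q ^ n * w ≠ 1) :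
    qProd Q w ≠ 0 := by
  have := tprod_one_add_ne_zero_of_summable (f := fun n : ℕ => -(Q ^ n * w))
    (fun n => by rw [← sub_eq_add_neg]; exact sub_ne_zero.2 (h n).symm)
    (summable_qProd hQ w)
  simpa only [← sub_eq_add_neg, qProd] using this

theorem differentiable_qProd {Q : ℂ} (hQ : ‖Q‖ < 1) : Differentiable ℂ (qProd Q) := by
  rw [← differentiableOn_univ]
  have : HasProdLocallyUniformlyOn (fun (n : ℕ) w => 1 - Q ^ n * w) (qProd Q) Set.univ := by
    simp_rw [sub_eq_add_neg]
    apply hasProdLocallyUniformlyOn_of_forall_compact isOpen_univ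
    intro K _ hK
    obtain ⟨r, hr⟩ := hK.isBounded.subset_closedBall 0
    have := ((summable_geometric_of_lt_one (norm_nonneg _) hQ).mul_right
      |r|).hasProdUniformlyOn_nat_one_add (f := fun (n : ℕ) w => -(Q ^ n * w)) hK
      (.of_forall fun n x hx ↦ ?_) (fun _ ↦ by fun_prop)
    · have e : qProd Q = fun x => ∏' n : ℕ, (1 + -(Q ^ n * x)) := by
        ext x; simp only [qProd, sub_eq_add_neg]
      rw [e]
      exact this
    · rw [norm_neg, norm_mul, norm_pow]
      have := mem_closedBall_zero_iff.1 (hr hx)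
      gcongr
      exact this.trans (le_abs_self r)
  refine this.differentiableOn (Filter.Eventually.of_forall fun s ↦ ?_) isOpen_univ
  exact DifferentiableOn.fun_finsetProd fun _ _ ↦ by fun_prop

/-! ### The theta function -/

theorem theta_eq_jacobiTheta₂ (τ x : ℂ) : theta τ x
    = -exp (Real.pi * I * τ / 4 + Real.pi * I * (x + 1 / 2))
      * jacobiTheta₂ (x + 1 / 2 + τ / 2) τ := by
  rw [theta, jacobiTheta₂, neg_mul, ← tsum_mul_left]
  congr 2
  ext k
  rw [jacobiTheta₂_term, ← exp_add]
  congr 1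
  ring

theorem differentiable_theta {τ : ℂ} (hτ : 0 < τ.im) : Differentiable ℂ (theta τ) := by
  have : theta τ = fun x => -exp (Real.pi * I * τ / 4 + Real.pi * I * (x + 1 / 2))
      * jacobiTheta₂ (x + 1 / 2 + τ / 2) τ := funext (theta_eq_jacobiTheta₂ τ)
  rw [this]
  have h2 : Differentiable ℂ fun x => jacobiTheta₂ (x + 1 / 2 + τ / 2) τ := fun x =>
    (differentiableAt_jacobiTheta₂_fst _ hτ).comp x (by fun_prop)
  fun_prop

theorem theta_add_one (τ x : ℂ) : theta τ (x + 1) = -theta τ x := by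
  rw [theta_eq_jacobiTheta₂, theta_eq_jacobiTheta₂,
    show x + 1 + 1 / 2 + τ / 2 = x + 1 / 2 + τ / 2 + 1 by ring, jacobiTheta₂_add_left,
    show Real.pi * I * τ / 4 + Real.pi * I * (x + 1 + 1 / 2)
      = Real.pi * I * τ / 4 + Real.pi * I * (x + 1 / 2) + Real.pi * I by ring, exp_add _ (_ * I),
    exp_pi_mul_I]
  ring

theorem exp_eq_neg_exp_of_int {x y : ℂ} (n : ℤ)
    (h : x = y + Real.pi * I + n * (2 * Real.pi * I)) : exp x = -exp y := by
  rw [h, exp_add, exp_add, exp_pi_mul_I, exp_int_mul_two_pi_mul_I]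
  ring

theorem theta_add_tau (τ x : ℂ) : theta τ (x + τ)
    = -exp (-(Real.pi * I * τ + 2 * Real.pi * I * x)) * theta τ x := by
  rw [theta_eq_jacobiTheta₂, theta_eq_jacobiTheta₂,
    show x + τ + 1 / 2 + τ / 2 = x + 1 / 2 + τ / 2 + τ by ring, jacobiTheta₂_add_left']
  have : exp (Real.pi * I * τ / 4 + Real.pi * I * (x + τ + 1 / 2))
      * exp (-Real.pi * I * (τ + 2 * (x + 1 / 2 + τ / 2)))
      = - (exp (-(Real.pi * I * τ + 2 * Real.pi * I * x))
        * exp (Real.pi * I * τ / 4 + Real.pi * I * (x + 1 / 2))) := by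
    rw [← exp_add, ← exp_add]
    exact exp_eq_neg_exp_of_int (-1) (by push_cast; ring)
  linear_combination -jacobiTheta₂ (x + 1 / 2 + τ / 2) τ * this

theorem theta_neg (τ x : ℂ) : theta τ (-x) = -theta τ x := by
  rw [theta_eq_jacobiTheta₂, theta_eq_jacobiTheta₂,
    show -x + 1 / 2 + τ / 2 = -(x + 1 / 2 + τ / 2) + 1 + τ by ring, jacobiTheta₂_add_left',
    jacobiTheta₂_add_left, jacobiTheta₂_neg_left]
  have : exp (Real.pi * I * τ / 4 + Real.pi * I * (-x + 1 / 2))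
      * exp (-Real.pi * I * (τ + 2 * (-(x + 1 / 2 + τ / 2) + 1)))
      = - exp (Real.pi * I * τ / 4 + Real.pi * I * (x + 1 / 2)) := by
    rw [← exp_add]
    exact exp_eq_neg_exp_of_int (-1) (by push_cast; ring)
  linear_combination -jacobiTheta₂ (x + 1 / 2 + τ / 2) τ * this

@[simp]
theorem theta_zero (τ : ℂ) : theta τ 0 = 0 := by
  have := theta_neg τ 0
  rw [neg_zero] at this
  exact self_eq_neg.1 this

theorem theta_eq_zero_of_inLattice {τ x : ℂ} (hx : InLattice τ x) : theta τ x = 0 := by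
  have h1 : Function.Periodic (fun x => theta τ x = 0) 1 := fun x => by
    simp only [theta_add_one, neg_eq_zero]
  have h2 : Function.Periodic (fun x => theta τ x = 0) τ := fun x => by
    simp [theta_add_tau]
  obtain ⟨m, n, rfl⟩ := hx
  have e1 := h2.int_mul n m
  have e2 := h1.int_mul m 0
  simp only [mul_one, zero_add, theta_zero, eq_iff_iff, iff_true] at e1 e2
  rwa [e1]

/-- The integral picks out the constant Fourier coefficient. It serves to show that θ is not
identically zero. -/
theorem integral_jacobiTheta₂ {τ : ℂ} (hτ : 0 < τ.im) :
    ∫ x in (0 : ℝ)..1, jacobiTheta₂ x τ = 1 := by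
  have hs : Summable fun n : ℤ => ‖jacobiTheta₂_term n 0 τ‖ :=
    ((summable_jacobiTheta₂_term_iff 0 τ).2 hτ).norm
  have hnorm : ∀ (n : ℤ) (x : ℝ), ‖jacobiTheta₂_term n x τ‖ = ‖jacobiTheta₂_term n 0 τ‖ := by
    intro n x
    simp [norm_jacobiTheta₂_term]
  have hcont : ∀ n : ℤ, Continuous fun x : ℝ => jacobiTheta₂_term n x τ := by
    intro n
    unfold jacobiTheta₂_term
    fun_prop
  have key := intervalIntegral.hasSum_integral_of_dominated_convergence
    (F := fun (n : ℤ) (x : ℝ) => jacobiTheta₂_term n x τ) (f := fun x : ℝ => jacobiTheta₂ x τ)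
    (a := 0) (b := 1) (μ := MeasureTheory.volume) (fun n _ => ‖jacobiTheta₂_term n 0 τ‖)
    (fun n => (hcont n).aestronglyMeasurable)
    (fun n => Filter.Eventually.of_forall fun x _ => (hnorm n x).le)
    (Filter.Eventually.of_forall fun x _ => hs)
    (by simp)
    (Filter.Eventually.of_forall fun x _ => hasSum_jacobiTheta₂_term x hτ)
  refine key.unique ?_
  have h0 : ∀ n : ℤ, n ≠ 0 → ∫ x in (0 : ℝ)..1, jacobiTheta₂_term n x τ = 0 := by
    intro n hn
    have hc : (2 * Real.pi * I * n : ℂ) ≠ 0 :=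
      mul_ne_zero two_pi_I_ne_zero (Int.cast_ne_zero.2 hn)
    simp only [jacobiTheta₂_term, exp_add, intervalIntegral.integral_mul_const]
    rw [integral_exp_mul_complex hc]
    have : exp (2 * Real.pi * I * n * (1 : ℝ)) = 1 := by
      rw [exp_eq_one_iff]
      exact ⟨n, by push_cast; ring⟩
    rw [this]
    simp
  have := hasSum_single (f := fun n : ℤ => ∫ x in (0 : ℝ)..1, jacobiTheta₂_term n x τ) 0 h0
  simpa [jacobiTheta₂_term] using this

theorem exists_theta_ne_zero {τ : ℂ} (hτ : 0 < τ.im) : ∃ x, theta τ x ≠ 0 := by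
  by_contra! h
  have : ∀ x, jacobiTheta₂ x τ = 0 := by
    intro x
    have := h (x - 1 / 2 - τ / 2)
    rw [theta_eq_jacobiTheta₂] at this
    have h2 := (mul_eq_zero.1 this).resolve_left (neg_ne_zero.2 (exp_ne_zero _))
    rwa [show x - 1 / 2 - τ / 2 + 1 / 2 + τ / 2 = x by ring] at h2
  have h1 := integral_jacobiTheta₂ hτ
  simp [this] at h1

/-- The product `∏_{n ≥ 0} (1 - q²ⁿ w) (1 - q²ⁿ⁺² w⁻¹)` with `w = exp (2πix)`, `q = exp (πiτ)`. -/
def thetaProd (τ x : ℂ) : ℂ :=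
  qProd (exp (2 * Real.pi * I * τ)) (exp (2 * Real.pi * I * x))
    * qProd (exp (2 * Real.pi * I * τ)) (exp (2 * Real.pi * I * (τ - x)))

theorem norm_exp_two_pi_I_lt_one' {τ : ℂ} (hτ : 0 < τ.im) : ‖exp (2 * Real.pi * I * τ)‖ < 1 := by
  simpa using UpperHalfPlane.norm_exp_two_pi_I_lt_one ⟨τ, hτ⟩

theorem differentiable_thetaProd {τ : ℂ} (hτ : 0 < τ.im) : Differentiable ℂ (thetaProd τ) := by
  have h := differentiable_qProd (norm_exp_two_pi_I_lt_one' hτ)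
  unfold thetaProd
  exact (h.comp (by fun_prop : Differentiable ℂ fun x => exp (2 * Real.pi * I * x))).mul
    (h.comp (by fun_prop : Differentiable ℂ fun x => exp (2 * Real.pi * I * (τ - x))))

theorem thetaProd_add_one (τ x : ℂ) : thetaProd τ (x + 1) = thetaProd τ x := by
  have h1 : exp (2 * Real.pi * I * (x + 1)) = exp (2 * Real.pi * I * x) :=
    exp_eq_exp_iff_exists_int.2 ⟨1, by push_cast; ring⟩
  have h2 : exp (2 * Real.pi * I * (τ - (x + 1))) = exp (2 * Real.pi * I * (τ - x)) :=
    exp_eq_exp_iff_exists_int.2 ⟨-1, by push_cast; ring⟩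
  rw [thetaProd, h1, h2, thetaProd]

theorem thetaProd_eq_mul {τ : ℂ} (hτ : 0 < τ.im) (x : ℂ) : thetaProd τ x
    = (1 - exp (2 * Real.pi * I * x)) * (qProd (exp (2 * Real.pi * I * τ))
        (exp (2 * Real.pi * I * (τ + x))) * qProd (exp (2 * Real.pi * I * τ))
        (exp (2 * Real.pi * I * (τ - x)))) := by
  rw [thetaProd, qProd_eq_mul (norm_exp_two_pi_I_lt_one' hτ) (exp (2 * Real.pi * I * x)),
    ← exp_add, ← mul_add, mul_assoc]

theorem thetaProd_add_tau {τ : ℂ} (hτ : 0 < τ.im) (x : ℂ) :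
    thetaProd τ (x + τ) = -exp (-(2 * Real.pi * I * x)) * thetaProd τ x := by
  rw [thetaProd_eq_mul hτ x, thetaProd, show τ - (x + τ) = -x by ring,
    qProd_eq_mul (norm_exp_two_pi_I_lt_one' hτ) (exp (2 * Real.pi * I * -x)),
    ← exp_add, ← mul_add, ← sub_eq_add_neg, add_comm x τ, mul_neg]
  have : exp (-(2 * Real.pi * I * x)) * exp (2 * Real.pi * I * x) = 1 := by
    rw [← exp_add]; simp
  linear_combination -(qProd (exp (2 * Real.pi * I * τ)) (exp (2 * Real.pi * I * (τ + x)))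
    * qProd (exp (2 * Real.pi * I * τ)) (exp (2 * Real.pi * I * (τ - x)))) * this

theorem inLattice_of_thetaProd_eq_zero {τ : ℂ} (hτ : 0 < τ.im) {x : ℂ} (hx : thetaProd τ x = 0) :
    InLattice τ x := by
  by_contra hL
  have hQ := norm_exp_two_pi_I_lt_one' hτ
  have key : ∀ (n : ℕ) (y : ℂ), exp (2 * Real.pi * I * τ) ^ n * exp (2 * Real.pi * I * y) = 1 →
      InLattice τ y := by
    intro n y h
    rw [← exp_nat_mul, ← exp_add, exp_eq_one_iff] at h
    obtain ⟨m, hm⟩ := h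
    refine ⟨m, -n, mul_left_cancel₀ two_pi_I_ne_zero ?_⟩
    push_cast
    linear_combination hm
  refine mul_ne_zero (qProd_ne_zero hQ fun n h => hL (key n x h))
    (qProd_ne_zero hQ fun n h => hL ?_) hx
  obtain ⟨a, b, hab⟩ := key n _ h
  exact ⟨-a, 1 - b, by push_cast; linear_combination -hab⟩

/-- Quasi-periodicity transports the claim from 0, where the factor `1 - exp(2πix)` has a simple
zero and the remaining factors do not vanish. -/
theorem deriv_thetaProd_ne_zero {τ : ℂ} (hτ : 0 < τ.im) {x : ℂ} (hx : InLattice τ x) :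
    deriv (thetaProd τ) x ≠ 0 := by
  have hQ := norm_exp_two_pi_I_lt_one' hτ
  have hd := differentiable_thetaProd hτ
  have h1 : Function.Periodic (fun x => thetaProd τ x = 0 ∧ deriv (thetaProd τ) x ≠ 0) 1 := by
    intro x
    have : deriv (thetaProd τ) (x + 1) = deriv (thetaProd τ) x := by
      rw [← deriv_comp_add_const]
      congr 1
      ext y
      exact thetaProd_add_one τ y
    simp only [thetaProd_add_one, this]
  have h2 : Function.Periodic (fun x => thetaProd τ x = 0 ∧ deriv (thetaProd τ) x ≠ 0) τ := by
    intro x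
    simp only [thetaProd_add_tau hτ, mul_eq_zero, neg_eq_zero, exp_ne_zero, false_or, eq_iff_iff]
    refine and_congr_right fun h0 => ?_
    have : deriv (thetaProd τ) (x + τ)
        = -exp (-(2 * Real.pi * I * x)) * deriv (thetaProd τ) x := by
      rw [← deriv_comp_add_const]
      have e : (fun y => thetaProd τ (y + τ))
          = fun y => -exp (-(2 * Real.pi * I * y)) * thetaProd τ y :=
        funext (thetaProd_add_tau hτ)
      rw [e, deriv_fun_mul (by fun_prop) (hd x), h0]
      ring
    rw [this]
    simp
  have h0 : thetaProd τ 0 = 0 ∧ deriv (thetaProd τ) 0 ≠ 0 := by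
    constructor
    · rw [thetaProd_eq_mul hτ]; simp
    · have e : thetaProd τ = fun x => (1 - exp (2 * Real.pi * I * x)) *
          (qProd (exp (2 * Real.pi * I * τ)) (exp (2 * Real.pi * I * (τ + x))) *
            qProd (exp (2 * Real.pi * I * τ)) (exp (2 * Real.pi * I * (τ - x)))) :=
        funext (thetaProd_eq_mul hτ)
      have hq := differentiable_qProd hQ
      have hR : Differentiable ℂ fun x =>
          (qProd (exp (2 * Real.pi * I * τ)) (exp (2 * Real.pi * I * (τ + x))) *
            qProd (exp (2 * Real.pi * I * τ)) (exp (2 * Real.pi * I * (τ - x)))) :=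
        (hq.comp (by fun_prop : Differentiable ℂ fun x => exp (2 * Real.pi * I * (τ + x)))).mul
          (hq.comp (by fun_prop : Differentiable ℂ fun x => exp (2 * Real.pi * I * (τ - x))))
      have hE : HasDerivAt (fun x : ℂ => 1 - exp (2 * Real.pi * I * x)) (-(2 * Real.pi * I)) 0 := by
        have := (((hasDerivAt_id (0 : ℂ)).const_mul (2 * Real.pi * I)).cexp).const_sub 1
        simpa using this
      rw [e, (hE.fun_mul (hR 0).hasDerivAt).deriv]
      simp only [mul_zero, exp_zero, sub_self, zero_mul, add_zero, sub_zero]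
      have hne : qProd (exp (2 * Real.pi * I * τ)) (exp (2 * Real.pi * I * τ)) ≠ 0 := by
        refine qProd_ne_zero hQ fun n h => ?_
        have : ‖exp (2 * Real.pi * I * τ)‖ ^ (n + 1) < 1 :=
          pow_lt_one₀ (norm_nonneg _) hQ n.succ_ne_zero
        rw [← norm_pow, pow_succ, h, norm_one] at this
        exact this.false
      exact mul_ne_zero (neg_ne_zero.2 two_pi_I_ne_zero) (mul_ne_zero hne hne)
  obtain ⟨m, n, rfl⟩ := hx
  have e1 := h2.int_mul n m
  have e2 := h1.int_mul m 0
  simp only [mul_one, zero_add] at e1 e2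
  exact (e1.mpr (e2.mpr h0)).2

/-- The theta function is a nonzero multiple of the infinite product. -/
theorem exists_theta_eq_thetaProd {τ : ℂ} (hτ : 0 < τ.im) :
    ∃ c : ℂ, c ≠ 0 ∧ ∀ x, theta τ x = c * exp (-(Real.pi * I * x)) * thetaProd τ x := by
  have hF : Differentiable ℂ fun x => theta τ x * exp (Real.pi * I * x) :=
    (differentiable_theta hτ).mul (by fun_prop)
  -- Only easy facts are needed: θ vanishes on the lattice, and the zeros of the product are simple
  -- and lie there. The quotient H is then entire and doubly periodic, hence constant, and the zeros
  -- of θ are read off from the product.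
  obtain ⟨H, hH, hFH⟩ := exists_eq_mul_of_simple_zeros hF (differentiable_thetaProd hτ)
    fun p hp => ⟨by rw [theta_eq_zero_of_inLattice (inLattice_of_thetaProd_eq_zero hτ hp), zero_mul],
      deriv_thetaProd_ne_zero hτ (inLattice_of_thetaProd_eq_zero hτ hp)⟩
  obtain ⟨x₀, hx₀⟩ := exists_theta_ne_zero hτ
  have hP : ∃ x, thetaProd τ x ≠ 0 := by
    refine ⟨x₀, fun h => ?_⟩
    exact hx₀ (theta_eq_zero_of_inLattice (inLattice_of_thetaProd_eq_zero hτ h))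
  have p1 : ∀ x, H (x + 1) = H x := by
    intro x
    rw [← sub_eq_zero]
    refine eq_zero_of_mul_eq_zero_of_differentiable (F := fun x => H (x + 1) - H x)
      (by fun_prop) (differentiable_thetaProd hτ) hP (fun y => ?_) x
    have e1 := hFH y
    have e2 := hFH (y + 1)
    rw [theta_add_one, thetaProd_add_one,
      exp_eq_neg_exp_of_int (y := Real.pi * I * y) 0 (by push_cast; ring)] at e2
    linear_combination e1 - e2
  have p2 : ∀ x, H (x + τ) = H x := by
    intro x
    rw [← sub_eq_zero]
    refine eq_zero_of_mul_eq_zero_of_differentiable (F := fun x => H (x + τ) - H x)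
      (by fun_prop) (differentiable_thetaProd hτ) hP (fun y => ?_) x
    have e1 := hFH y
    have e2 := hFH (y + τ)
    rw [theta_add_tau, thetaProd_add_tau hτ] at e2
    have e3 : exp (-(Real.pi * I * τ + 2 * Real.pi * I * y)) * exp (Real.pi * I * (y + τ))
        = exp (-(2 * Real.pi * I * y)) * exp (Real.pi * I * y) := by
      rw [← exp_add, ← exp_add]
      congr 1
      ring
    have hne : exp (-(2 * Real.pi * I * y)) ≠ 0 := exp_ne_zero _
    apply mul_left_cancel₀ hne
    linear_combination e2 + theta τ y * e3 + exp (-(2 * Real.pi * I * y)) * e1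
  have hc := eq_of_doubly_periodic hτ hH p1 p2
  have hmain : ∀ x, theta τ x = H 0 * exp (-(Real.pi * I * x)) * thetaProd τ x := by
    intro x
    have e1 := hFH x
    rw [hc x 0] at e1
    have e2 : exp (Real.pi * I * x) * exp (-(Real.pi * I * x)) = 1 := by rw [← exp_add]; simp
    linear_combination exp (-(Real.pi * I * x)) * e1 - theta τ x * e2
  refine ⟨H 0, fun h => hx₀ ?_, hmain⟩
  rw [hmain, h, zero_mul, zero_mul]

theorem theta_eq_zero_iff {τ : ℂ} (hτ : 0 < τ.im) {x : ℂ} : theta τ x = 0 ↔ InLattice τ x := by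
  refine ⟨fun h => ?_, theta_eq_zero_of_inLattice⟩
  obtain ⟨c, hc, hθ⟩ := exists_theta_eq_thetaProd hτ
  rw [hθ] at h
  exact inLattice_of_thetaProd_eq_zero hτ
    ((mul_eq_zero.1 h).resolve_left (mul_ne_zero hc (exp_ne_zero _)))

theorem deriv_theta_ne_zero {τ : ℂ} (hτ : 0 < τ.im) {x : ℂ} (hx : theta τ x = 0) :
    deriv (theta τ) x ≠ 0 := by
  obtain ⟨c, hc, hθ⟩ := exists_theta_eq_thetaProd hτ
  have h0 : thetaProd τ x = 0 := by
    rw [hθ] at hx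
    exact (mul_eq_zero.1 hx).resolve_left (mul_ne_zero hc (exp_ne_zero _))
  rw [funext hθ, deriv_fun_mul (by fun_prop) (differentiable_thetaProd hτ x), h0, mul_zero, zero_add]
  exact mul_ne_zero (mul_ne_zero hc (exp_ne_zero _))
    (deriv_thetaProd_ne_zero hτ ((theta_eq_zero_iff hτ).1 hx))

/-! ### Theta functions of higher degree -/

theorem theta_sub_comm (τ x y : ℂ) : theta τ (x - y) = -theta τ (y - x) := by
  rw [← theta_neg, neg_sub]

/-- The zeros are divided out one class modulo Λ at a time; the classes being distinct, the quotient
keeps the remaining zeros. -/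
theorem exists_eq_prod_theta_mul {τ : ℂ} (hτ : 0 < τ.im) {ι : Type*} (S : Finset ι) (y : ι → ℂ)
    (hy : ∀ i ∈ S, ∀ j ∈ S, i ≠ j → theta τ (y i - y j) ≠ 0) {F : ℂ → ℂ} (hF : Differentiable ℂ F)
    (hz : ∀ i ∈ S, ∀ x, theta τ (x - y i) = 0 → F x = 0) :
    ∃ H : ℂ → ℂ, Differentiable ℂ H ∧ ∀ x, F x = (∏ i ∈ S, theta τ (x - y i)) * H x := by
  classical
  induction S using Finset.induction_on generalizing F with
  | empty => exact ⟨F, hF, by simp⟩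
  | insert a S ha ih =>
    have hθ := differentiable_theta hτ
    have hG : Differentiable ℂ fun x => theta τ (x - y a) := hθ.comp (by fun_prop)
    obtain ⟨H, hH, hFH⟩ := exists_eq_mul_of_simple_zeros hF hG fun p hp =>
      ⟨hz a (Finset.mem_insert_self a S) p hp, by
        rw [deriv_comp_sub_const]; exact deriv_theta_ne_zero hτ hp⟩
    obtain ⟨H', hH', hHH'⟩ := ih (fun i hi j hj => hy i (Finset.mem_insert_of_mem hi) j
      (Finset.mem_insert_of_mem hj)) hH (by
        intro i hi x hx
        have h0 := hFH x
        rw [hz i (Finset.mem_insert_of_mem hi) x hx] at h0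
        refine (mul_eq_zero.1 h0.symm).resolve_left fun h1 => ?_
        refine hy i (Finset.mem_insert_of_mem hi) a (Finset.mem_insert_self a S)
          (fun h => ha (h ▸ hi)) ?_
        rw [theta_eq_zero_iff hτ] at hx h1 ⊢
        obtain ⟨m, n, h2⟩ := hx
        obtain ⟨m', n', h3⟩ := h1
        exact ⟨m' - m, n' - n, by push_cast; linear_combination h3 - h2⟩)
    refine ⟨H', hH', fun x => ?_⟩
    rw [hFH, hHH', Finset.prod_insert ha, mul_assoc]

theorem eq_zero_of_quasiPeriodic {τ : ℂ} (hτ : 0 < τ.im) {F u v : ℂ → ℂ}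
    (h1 : ∀ x, F (x + 1) = u x * F x) (h2 : ∀ x, F (x + τ) = v x * F x)
    (hu : ∀ x, u x ≠ 0) (hv : ∀ x, v x ≠ 0) {x y : ℂ} (hy : F y = 0)
    (hxy : theta τ (x - y) = 0) : F x = 0 := by
  have p1 : Function.Periodic (fun x => F x = 0) 1 := fun x => by simp [h1, hu]
  have p2 : Function.Periodic (fun x => F x = 0) τ := fun x => by simp [h2, hv]
  obtain ⟨m, n, h⟩ := (theta_eq_zero_iff hτ).1 hxy
  have e1 := p2.int_mul n (y + m)
  have e2 := p1.int_mul m y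
  rw [show x = y + m + n * τ by linear_combination h]
  simp only [mul_one] at e1 e2
  exact e1.mpr (e2.mpr hy)

/-- A theta function of degree `n` with `n` prescribed zeros vanishes, if the zeros do not have
the sum prescribed by the multipliers. -/
theorem eq_zero_of_theta_multipliers {τ ζ : ℂ} (hτ : 0 < τ.im) (hζ : ¬ InLattice τ ζ)
    {ι : Type*} (S : Finset ι) (y : ι → ℂ)
    (hy : ∀ i ∈ S, ∀ j ∈ S, i ≠ j → theta τ (y i - y j) ≠ 0) {F : ℂ → ℂ} (hF : Differentiable ℂ F)
    (h1 : ∀ x, F (x + 1) = (-1) ^ S.card * F x)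
    (h2 : ∀ x, F (x + τ) = exp (-(2 * Real.pi * I * ζ))
      * (∏ i ∈ S, -exp (-(Real.pi * I * τ + 2 * Real.pi * I * (x - y i)))) * F x)
    (h0 : ∀ i ∈ S, F (y i) = 0) (x : ℂ) : F x = 0 := by
  obtain ⟨H, hH, hFH⟩ := exists_eq_prod_theta_mul hτ S y hy hF fun i hi x hx =>
    eq_zero_of_quasiPeriodic hτ h1 h2 (fun _ => by simp)
      (fun x => mul_ne_zero (exp_ne_zero _) (Finset.prod_ne_zero_iff.2 fun j _ =>
        neg_ne_zero.2 (exp_ne_zero _))) (h0 i hi) hx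
  have hθ := differentiable_theta hτ
  have hP : Differentiable ℂ fun x => ∏ i ∈ S, theta τ (x - y i) :=
    Differentiable.fun_finsetProd fun i _ => hθ.comp (by fun_prop)
  have hP1 : ∀ x, ∏ i ∈ S, theta τ (x + 1 - y i) = (-1) ^ S.card * ∏ i ∈ S, theta τ (x - y i) := by
    intro x
    rw [← Finset.prod_const, ← Finset.prod_mul_distrib]
    refine Finset.prod_congr rfl fun i _ => ?_
    rw [add_sub_right_comm, theta_add_one, neg_one_mul]
  have hP2 : ∀ x, ∏ i ∈ S, theta τ (x + τ - y i)
      = (∏ i ∈ S, -exp (-(Real.pi * I * τ + 2 * Real.pi * I * (x - y i))))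
        * ∏ i ∈ S, theta τ (x - y i) := by
    intro x
    rw [← Finset.prod_mul_distrib]
    refine Finset.prod_congr rfl fun i _ => ?_
    rw [add_sub_right_comm, theta_add_tau]
  -- If the product is not identically zero, H has the multipliers 1 and `exp(-2πiζ)` of the
  -- degree-zero case. If it were, F would vanish with it.
  by_cases hne : ∃ x, ∏ i ∈ S, theta τ (x - y i) ≠ 0
  · have p1 : ∀ x, H (x + 1) = H x := by
      intro x
      rw [← sub_eq_zero]
      refine eq_zero_of_mul_eq_zero_of_differentiable (F := fun x => H (x + 1) - H x)
        (by fun_prop) hP hne (fun z => ?_) x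
      have e1 := hFH (z + 1)
      rw [h1, hP1, hFH] at e1
      have : ((-1 : ℂ) ^ S.card) ≠ 0 := by simp
      apply mul_left_cancel₀ this
      linear_combination -e1
    have p2 : ∀ x, H (x + τ) = exp (-(2 * Real.pi * I * ζ)) * H x := by
      intro x
      rw [← sub_eq_zero]
      refine eq_zero_of_mul_eq_zero_of_differentiable
        (F := fun x => H (x + τ) - exp (-(2 * Real.pi * I * ζ)) * H x)
        (by fun_prop) hP hne (fun z => ?_) x
      have e1 := hFH (z + τ)
      rw [h2, hP2, hFH] at e1
      have : ∏ i ∈ S, -exp (-(Real.pi * I * τ + 2 * Real.pi * I * (z - y i))) ≠ 0 :=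
        Finset.prod_ne_zero_iff.2 fun j _ => neg_ne_zero.2 (exp_ne_zero _)
      apply mul_left_cancel₀ this
      linear_combination -e1
    rw [hFH, eq_zero_of_multipliers hτ hζ hH p1 p2, mul_zero]
  · push Not at hne
    rw [hFH, hne, zero_mul]

/-! ### Fay's identity and the elliptic Cauchy determinant -/

/-- As a function of ζ, the difference of the two sides is a theta function of degree 2 vanishing at
0 and -a, which are inequivalent as `θ(a) ≠ 0`. The sum of these zeros misses the one prescribed by
the multipliers by b, which is not in the lattice. -/
theorem theta_fay {τ : ℂ} (hτ : 0 < τ.im) {a b : ℂ} (ha : theta τ a ≠ 0) (hb : theta τ b ≠ 0)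
    {c d : ℂ} (h : a + b = c + d) (ζ : ℂ) :
    theta τ (ζ + a) * theta τ (ζ + b) * theta τ c * theta τ d
      - theta τ (ζ + c) * theta τ (ζ + d) * theta τ a * theta τ b
      = theta τ ζ * theta τ (ζ + a + b) * theta τ (a - c) * theta τ (a - d) := by
  have hθ := differentiable_theta hτ
  have hs : ∀ r : ℂ, Differentiable ℂ fun x => theta τ (x + r) := fun r => hθ.comp (by fun_prop)
  have hb' : ¬ InLattice τ b := fun h => hb ((theta_eq_zero_iff hτ).2 h)
  set F : ℂ → ℂ := fun ζ => theta τ (ζ + a) * theta τ (ζ + b) * theta τ c * theta τ d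
      - theta τ (ζ + c) * theta τ (ζ + d) * theta τ a * theta τ b
      - theta τ ζ * theta τ (ζ + a + b) * theta τ (a - c) * theta τ (a - d) with hFdef
  suffices hF0 : F ζ = 0 by
    rw [hFdef] at hF0
    linear_combination hF0
  have hd : d = a + b - c := by linear_combination -h
  let y : Bool → ℂ := fun t => if t then 0 else -a
  have hF : Differentiable ℂ F := by
    have h1 := hs a
    have h2 := hs b
    have h3 := hs c
    have h4 := hs d
    have h5 : Differentiable ℂ fun x => theta τ (x + a + b) := hθ.comp (by fun_prop)
    fun_prop
  refine eq_zero_of_theta_multipliers hτ hb' (Finset.univ : Finset Bool) y ?_ hF ?_ ?_ ?_ ζ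
  · intro i _ j _ hij
    cases i <;> cases j <;> simp_all [y, theta_neg]
  · intro x
    simp only [hFdef, add_right_comm x 1, theta_add_one]
    rw [add_right_comm, theta_add_one]
    simp
  · intro x
    simp only [hFdef, add_right_comm x τ, theta_add_tau]
    rw [add_right_comm (x + a) τ, theta_add_tau]
    simp only [Fintype.prod_bool, y]
    have key : ∀ p q : ℂ, p + q = a + b →
        exp (-(Real.pi * I * τ + 2 * Real.pi * I * (x + p)))
          * exp (-(Real.pi * I * τ + 2 * Real.pi * I * (x + q)))
        = exp (-(2 * Real.pi * I * b)) * (exp (-(Real.pi * I * τ + 2 * Real.pi * I * (x - 0)))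
          * exp (-(Real.pi * I * τ + 2 * Real.pi * I * (x - -a)))) := by
      intro p q hpq
      rw [← exp_add, ← exp_add, ← exp_add]
      congr 1
      linear_combination -2 * Real.pi * I * hpq
    have k1 := key a b rfl
    have k2 := key c d h.symm
    have k3 := key 0 (a + b) (by ring)
    simp only [add_zero, ← add_assoc] at k3
    simp only [if_true, Bool.false_eq_true, if_false]
    linear_combination (theta τ (x + a) * theta τ (x + b) * theta τ c * theta τ d) * k1
      - (theta τ (x + c) * theta τ (x + d) * theta τ a * theta τ b) * k2
      - (theta τ x * theta τ (x + a + b) * theta τ (a - c) * theta τ (a - d)) * k3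
  · intro i _
    cases i
    · simp only [y, hFdef, Bool.false_eq_true, if_false]
      rw [show -a + a = 0 by ring, show -a + c = -(a - c) by ring,
        show -a + d = -(a - d) by ring, theta_neg, theta_neg, theta_neg, theta_zero]
      ring_nf
    · simp only [y, hFdef, if_true, zero_add, theta_zero]
      ring

/-- The `ζ`-independent factor of the elliptic Cauchy determinant. -/
def cauchyFactor (τ : ℂ) {α : Type*} [Fintype α] [DecidableEq α] (a : α → ℂ) : ℂ :=
  (∏ i, ∏ j, if i = j then 1 else theta τ (a i - a j)) / ∏ i, ∏ j, theta τ (a i + a j)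

/-- The elliptic Cauchy matrix. -/
def cauchyTheta (τ ζ : ℂ) {α : Type*} (a : α → ℂ) : Matrix α α ℂ :=
  Matrix.of fun i j => theta τ (ζ - a i - a j) / theta τ (a i + a j)

theorem cauchyFactor_option {τ : ℂ} {α : Type*} [Fintype α] [DecidableEq α] (a : Option α → ℂ) :
    cauchyFactor τ a = (-1) ^ Fintype.card α * (∏ i, theta τ (a none - a (some i))
        / theta τ (a none + a (some i))) ^ 2 / theta τ (a none + a none)
      * cauchyFactor τ (a ∘ some) := by
  have h1 : ∏ i, theta τ (a (some i) - a none)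
      = (-1) ^ Fintype.card α * ∏ i, theta τ (a none - a (some i)) := by
    rw [← Finset.card_univ, ← Finset.prod_const, ← Finset.prod_mul_distrib]
    exact Finset.prod_congr rfl fun i _ => by rw [theta_sub_comm, neg_one_mul]
  have h2 : ∏ i, theta τ (a (some i) + a none) = ∏ i, theta τ (a none + a (some i)) :=
    Finset.prod_congr rfl fun i _ => by rw [add_comm]
  simp only [cauchyFactor, Fintype.prod_option, Finset.prod_mul_distrib, Finset.prod_div_distrib,
    Option.some.injEq, reduceCtorEq, if_true, if_false, one_mul, h1, h2, Function.comp_apply]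
  field_simp

theorem differentiable_det_cauchyTheta {τ : ℂ} (hτ : 0 < τ.im) {α : Type*} [Fintype α]
    [DecidableEq α] (a : α → ℂ) : Differentiable ℂ fun ζ => (cauchyTheta τ ζ a).det := by
  have hθ := differentiable_theta hτ
  simp only [Matrix.det_apply, cauchyTheta, Matrix.of_apply]
  refine Differentiable.fun_sum fun σ _ => Differentiable.const_smul ?_ _
  refine Differentiable.fun_finsetProd fun i _ => Differentiable.div_const ?_ _
  exact hθ.comp (by fun_prop)

theorem det_option_schur {α : Type*} [Fintype α] [DecidableEq α] {R : Type*} [Field R]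
    (M : Matrix (Option α) (Option α) R) (h : M none none ≠ 0) :
    M.det = M none none * (Matrix.of fun i j => M (some i) (some j)
      - M (some i) none * M none (some j) / M none none).det := by
  classical
  have e : (M.submatrix (Equiv.optionEquivSumPUnit.{0} α).symm (Equiv.optionEquivSumPUnit.{0} α).symm)
      = Matrix.fromBlocks (Matrix.of fun i j => M (some i) (some j))
        (Matrix.of fun i _ => M (some i) none) (Matrix.of fun _ j => M none (some j))
        (Matrix.diagonal fun _ => M none none) := by
    ext i j
    rcases i with i | i <;> rcases j with j | j <;> simp
  let _ : Invertible (Matrix.diagonal fun _ : Unit => M none none) :=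
    ⟨Matrix.diagonal fun _ => (M none none)⁻¹,
      by rw [Matrix.diagonal_mul_diagonal]; simp [h],
      by rw [Matrix.diagonal_mul_diagonal]; simp [h]⟩
  have hinv : ⅟ (Matrix.diagonal fun _ : Unit => M none none)
      = Matrix.diagonal fun _ => (M none none)⁻¹ := rfl
  rw [← Matrix.det_submatrix_equiv_self (Equiv.optionEquivSumPUnit.{0} α).symm M, e,
    Matrix.det_fromBlocks₂₂, hinv]
  congr 1
  · simp
  · congr 1
    ext i j
    simp [Matrix.mul_apply]
    ring

/-- Induction on the size, pivoting on the entry at `none`. By Fay's identity the Schur complement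
is again a Cauchy matrix, with ζ replaced by `ζ - 2 a none`, up to a scalar and row and column
factors. The factor `θ(ζ)` on the left lets the empty matrix fit the formula, which otherwise has
exponent `card α - 1`. -/
theorem det_cauchyTheta {τ : ℂ} (hτ : 0 < τ.im) (α : Type*) [Fintype α] [DecidableEq α] :
    ∀ (a : α → ℂ), (∀ i j, theta τ (a i + a j) ≠ 0) → ∀ ζ,
      (cauchyTheta τ ζ a).det * theta τ ζ
        = (-1) ^ (Fintype.card α).choose 2 * theta τ ζ ^ Fintype.card α
          * theta τ (ζ - 2 * ∑ i, a i) * cauchyFactor τ a := by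
  have hθ := differentiable_theta hτ
  suffices H : ∀ (i1 : DecidableEq α) (a : α → ℂ), (∀ i j, theta τ (a i + a j) ≠ 0) → ∀ ζ,
      (cauchyTheta τ ζ a).det * theta τ ζ
        = (-1) ^ (Fintype.card α).choose 2 * theta τ ζ ^ Fintype.card α
          * theta τ (ζ - 2 * ∑ i, a i) * cauchyFactor τ a from H _
  refine Fintype.induction_empty_option (P := fun α _ =>
    ∀ (i1 : DecidableEq α) (a : α → ℂ), (∀ i j, theta τ (a i + a j) ≠ 0) → ∀ ζ,
      (cauchyTheta τ ζ a).det * theta τ ζ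
        = (-1) ^ (Fintype.card α).choose 2 * theta τ ζ ^ Fintype.card α
          * theta τ (ζ - 2 * ∑ i, a i) * cauchyFactor τ a) ?_ ?_ ?_ α
  · intro α β _ e ih i1 a ha ζ
    let _ := Fintype.ofEquiv β e.symm
    let i2 : DecidableEq α := e.decidableEq
    have h := ih i2 (a ∘ e) (fun i j => ha _ _) ζ
    have h1 : cauchyTheta τ ζ (a ∘ e) = (cauchyTheta τ ζ a).submatrix e e := rfl
    have h2 : ∑ i, (a ∘ e) i = ∑ i, a i := Equiv.sum_comp e a
    have h3 : cauchyFactor τ (a ∘ e) = cauchyFactor τ a := by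
      unfold cauchyFactor
      rw [← Equiv.prod_comp e, ← Equiv.prod_comp e]
      congr 1
      · refine Finset.prod_congr rfl fun i _ => ?_
        rw [← Equiv.prod_comp e]
        simp
      · refine Finset.prod_congr rfl fun i _ => ?_
        rw [← Equiv.prod_comp e]
        simp
    rw [h1, Matrix.det_submatrix_equiv_self, h2, h3, Fintype.card_congr e] at h
    exact h
  · intro i1 a _ ζ
    simp [cauchyFactor]
  · intro α _ ih i1 a ha ζ
    have i2 : DecidableEq α := Classical.decEq α
    obtain rfl : i1 = Option.instDecidableEq := Subsingleton.elim _ _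
    rw [← sub_eq_zero]
    -- The pivot must be nonzero and `θ(ζ)` invertible; the excluded values of ζ are recovered by
    -- the identity theorem.
    refine eq_zero_of_mul_eq_zero_of_differentiable (F := fun ζ =>
      (cauchyTheta τ ζ a).det * theta τ ζ - (-1) ^ (Fintype.card (Option α)).choose 2
        * theta τ ζ ^ Fintype.card (Option α) * theta τ (ζ - 2 * ∑ i, a i) * cauchyFactor τ a)
      (G := fun ζ => theta τ ζ * theta τ (ζ - 2 * a none)) ?_ ?_ ?_ ?_ ζ
    · have h1 := differentiable_det_cauchyTheta hτ a
      have h2 : Differentiable ℂ fun ζ => theta τ (ζ - 2 * ∑ i, a i) := hθ.comp (by fun_prop)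
      fun_prop
    · exact hθ.mul (hθ.comp (by fun_prop))
    · by_contra! hc
      obtain ⟨x, hx⟩ := exists_theta_ne_zero hτ
      refine hx ?_
      have := eq_zero_of_mul_eq_zero_of_differentiable
        (F := fun ζ => theta τ (ζ - 2 * a none)) (hθ.comp (by fun_prop)) hθ
        (exists_theta_ne_zero hτ) hc (x + 2 * a none)
      simpa using this
    · intro ζ
      by_cases h0 : theta τ ζ = 0
      · simp [h0]
      by_cases h1 : theta τ (ζ - 2 * a none) = 0
      · simp [h1]
      have hp : cauchyTheta τ ζ a none none
          = theta τ (ζ - 2 * a none) / theta τ (a none + a none) := by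
        simp only [cauchyTheta, Matrix.of_apply]
        congr 2
        ring
      have hp0 : cauchyTheta τ ζ a none none ≠ 0 := by
        rw [hp]
        exact div_ne_zero h1 (ha _ _)
      set r : α → ℂ := fun i => theta τ (a none - a (some i)) / theta τ (a none + a (some i))
        with hr
      have hS : (Matrix.of fun i j => cauchyTheta τ ζ a (some i) (some j)
          - cauchyTheta τ ζ a (some i) none * cauchyTheta τ ζ a none (some j)
            / cauchyTheta τ ζ a none none)
          = (theta τ ζ / theta τ (ζ - 2 * a none)) • (Matrix.of fun i j => r i *
            (Matrix.of fun i j => r j *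
              cauchyTheta τ (ζ - 2 * a none) (a ∘ some) i j) i j) := by
        ext i j
        have hf := theta_fay hτ (a := -(a (some i) + a (some j))) (b := -(a none + a none))
          (c := -(a (some i) + a none)) (d := -(a none + a (some j)))
          (by rw [theta_neg]; exact neg_ne_zero.2 (ha _ _))
          (by rw [theta_neg]; exact neg_ne_zero.2 (ha _ _)) (by ring) ζ
        simp only [theta_neg] at hf
        have n1 := ha (some i) (some j)
        have n2 := ha (some i) none
        have n3 := ha none (some j)
        have n4 := ha none none
        rw [hp]
        simp only [cauchyTheta, Matrix.of_apply, Matrix.smul_apply, smul_eq_mul, hr,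
          Function.comp_apply]
        rw [show ζ + -(a (some i) + a (some j)) = ζ - a (some i) - a (some j) by ring,
          show ζ + -(a none + a none) = ζ - 2 * a none by ring,
          show ζ + -(a (some i) + a none) = ζ - a (some i) - a none by ring,
          show ζ + -(a none + a (some j)) = ζ - a none - a (some j) by ring,
          show ζ - a (some i) - a (some j) + -(a none + a none)
            = ζ - 2 * a none - a (some i) - a (some j) by ring,
          show -(a (some i) + a (some j)) - -(a (some i) + a none)
            = a none - a (some j) by ring,
          show -(a (some i) + a (some j)) - -(a none + a (some j))
            = a none - a (some i) by ring] at hf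
        rw [add_comm (a none) (a (some i))]
        generalize theta τ (a none + a none) = t1 at *
        generalize theta τ (ζ - 2 * a none) = t2 at *
        generalize theta τ (ζ - 2 * a none - a (some i) - a (some j)) = t3 at *
        field_simp
        linear_combination hf
      have hih := ih i2 (a ∘ some) (fun i j => ha _ _) (ζ - 2 * a none)
      rw [det_option_schur _ hp0, hS, Matrix.det_smul, Matrix.det_mul_column, Matrix.det_mul_row, hp,
        cauchyFactor_option, Fintype.sum_option, Fintype.card_option, Nat.choose_succ_succ' _ 1,
        Nat.choose_one_right]
      rw [show ζ - 2 * a none - 2 * ∑ i, (a ∘ some) i = ζ - 2 * (a none + ∑ i, a (some i)) by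
        simp only [Function.comp_apply]; ring] at hih
      have hsq : ((-1 : ℂ) ^ Fintype.card α) * (-1) ^ Fintype.card α = 1 := by
        rw [← mul_pow]; simp
      have n4 := ha none none
      have h1n := pow_ne_zero (Fintype.card α) h1
      have hr2 : ∏ i, theta τ (a none - a (some i)) / theta τ (a none + a (some i)) = ∏ i, r i :=
        rfl
      rw [mul_eq_zero]
      right
      rw [sub_eq_zero, pow_add, div_pow, hr2]
      generalize ∏ i, r i = ρ at *
      generalize (cauchyTheta τ (ζ - 2 * a none) (a ∘ some)).det = D at *
      generalize theta τ (ζ - 2 * (a none + ∑ i, a (some i))) = X at *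
      generalize cauchyFactor τ (a ∘ some) = C at *
      generalize theta τ (ζ - 2 * a none) = T' at *
      generalize theta τ ζ = T at *
      generalize theta τ (a none + a none) = t1 at *
      field_simp
      linear_combination (T ^ Fintype.card α * ρ ^ 2 * T) * hih
        - T' ^ Fintype.card α * ρ ^ 2 * (-1) ^ (Fintype.card α).choose 2 * T ^ (Fintype.card α + 1)
          * X * C * hsq

/-! ### Expansion of the determinant -/

/-- The determinant is multilinear in the rows. If the rows in s come from A and the others from the
diagonal, the matrix is block triangular. -/
theorem det_diagonal_add {n R : Type*} [Fintype n] [DecidableEq n] [CommRing R] (d : n → R)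
    (A : Matrix n n R) : (Matrix.diagonal d + A).det
      = ∑ s : Finset n, (∏ i ∈ sᶜ, d i)
        * (A.submatrix (Subtype.val : s → n) (Subtype.val : s → n)).det := by
  have h : (Matrix.diagonal d + A).det = ∑ s : Finset n,
      (Matrix.of (s.piecewise A (Matrix.diagonal d))).det := by
    rw [add_comm]
    exact (Matrix.detRowAlternating (R := R) (n := n)).toMultilinearMap.map_add_univ A
      (Matrix.diagonal d)
  rw [h]
  refine Finset.sum_congr rfl fun s _ => ?_
  rw [Matrix.twoBlockTriangular_det _ (fun i => i ∈ s)]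
  · rw [mul_comm]
    have h1 : (Matrix.toSquareBlockProp (Matrix.of (s.piecewise A (Matrix.diagonal d)))
        fun i => ¬ i ∈ s) = Matrix.diagonal fun i : {a // ¬ a ∈ s} => d i := by
      ext ⟨i, hi⟩ ⟨j, hj⟩
      simp [Matrix.toSquareBlockProp, Finset.piecewise, hi, Matrix.diagonal_apply]
    have h2 : (Matrix.toSquareBlockProp (Matrix.of (s.piecewise A (Matrix.diagonal d)))
        fun i => i ∈ s) = A.submatrix (Subtype.val : s → n) (Subtype.val : s → n) := by
      ext ⟨i, hi⟩ ⟨j, hj⟩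
      simp [Matrix.toSquareBlockProp, Finset.piecewise, hi]
    rw [h1, h2, Matrix.det_diagonal]
    congr 1
    · exact (Finset.prod_subtype _ (fun x => by simp) d).symm
    · congr!
  · intro i hi j hj
    have : i ≠ j := fun h => hi (h ▸ hj)
    simp [Finset.piecewise, hi, this]

theorem prod_prod_sign (J : Finset ℕ) :
    ∏ i ∈ J, ∏ j ∈ J, (if i < j then (-1 : ℂ) else 1) = (-1) ^ J.card.choose 2 := by
  induction J using Finset.induction_on_max with
  | empty => simp
  | insert a s hs ih =>
    have ha : a ∉ s := fun h => (hs a h).false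
    have h1 : ∏ j ∈ s, (if a < j then (-1 : ℂ) else 1) = 1 :=
      Finset.prod_eq_one fun j hj => if_neg (hs j hj).le.not_gt
    have h2 : ∏ i ∈ s, (if i < a then (-1 : ℂ) else 1) = (-1) ^ s.card := by
      rw [Finset.prod_congr rfl fun i hi => if_pos (hs i hi), Finset.prod_const]
    simp only [Finset.prod_insert ha, Finset.prod_mul_distrib, ih, h1, h2, lt_irrefl, if_false,
      Finset.card_insert_of_notMem ha, Nat.choose_succ_succ' _ 1, Nat.choose_one_right, pow_add,
      one_mul]

theorem prod_sign_Icc {l i : ℕ} (hi : i ≤ l) :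
    (-1 : ℂ) ^ l * ∏ j ∈ Finset.Icc 1 l, (if i < j then (-1 : ℂ) else 1) = (-1) ^ i := by
  have : (Finset.Icc 1 l).filter (fun j => i < j) = Finset.Icc (i + 1) l := by
    ext j; simp; omega
  rw [Finset.prod_ite, this]
  simp only [Finset.prod_const, one_pow, mul_one, Nat.card_Icc]
  rw [← pow_add, show l + (l + 1 - (i + 1)) = i + 2 * (l - i) by omega, pow_add, pow_mul]
  simp

/-- The three signs come from the rows of G, from the Cauchy determinant and from removing the
absolute values `|k - k'|`. For each i in J they combine to `(-1)^l` times one sign for every j with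
i < j ≤ l, hence to `(-1)^(l + (l - i)) = (-1)^i`. -/
theorem sign_identity {l : ℕ} {J : Finset ℕ} (hJ : J ⊆ Finset.Icc 1 l) :
    (∏ _i ∈ J, (-1 : ℂ) ^ l) * (-1) ^ J.card.choose 2
      * ∏ i ∈ J, ∏ j ∈ Finset.Icc 1 l \ J, (if i < j then (-1 : ℂ) else 1)
      = (-1) ^ ∑ i ∈ J, i := by
  rw [← prod_prod_sign, ← Finset.prod_mul_distrib, ← Finset.prod_mul_distrib,
    ← Finset.prod_pow_eq_pow_sum]
  refine Finset.prod_congr rfl fun i hi => ?_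
  rw [mul_assoc, mul_comm (∏ j ∈ J, _), Finset.prod_sdiff hJ,
    prod_sign_Icc (Finset.mem_Icc.1 (hJ hi)).2]

theorem theta_mul_ne_zero {τ η : ℂ} {l : ℕ} (hτ : 0 < τ.im)
    (hη : ∀ j : ℕ, 1 ≤ j → j ≤ 2 * l → ¬ InLattice τ (j * η)) {j : ℤ} (h0 : j ≠ 0)
    (h1 : -(2 * l) ≤ j) (h2 : j ≤ 2 * l) : theta τ (j * η) ≠ 0 := by
  rcases le_total 0 j with h | h
  · obtain ⟨k, rfl⟩ := Int.eq_ofNat_of_zero_le h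
    rw [Ne, theta_eq_zero_iff hτ]
    exact_mod_cast hη k (by omega) (by omega)
  · obtain ⟨k, hk⟩ := Int.eq_ofNat_of_zero_le (neg_nonneg.2 h)
    obtain rfl : j = -k := by omega
    have : theta τ (k * η) ≠ 0 := by
      rw [Ne, theta_eq_zero_iff hτ]
      exact hη k (by omega) (by omega)
    push_cast
    rwa [neg_mul, theta_neg, neg_ne_zero]

theorem enum_neg (τ η : ℂ) (j : ℤ) : enum τ η (-j) = -enum τ η j := by
  simp [enum, theta_neg, neg_div]

theorem enum_div_enum {τ η : ℂ} (h : theta τ η ≠ 0) (i j : ℤ) :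
    enum τ η i / enum τ η j = theta τ (i * η) / theta τ (j * η) := by
  rw [enum, enum, div_div_div_cancel_right₀ h]

theorem enum_div_enum_abs (τ η : ℂ) (a : ℂ) (i j : ℕ) :
    a / enum τ η ((i : ℤ) - j)
      = a / enum τ η |(i : ℤ) - j| * (if i < j then (-1 : ℂ) else 1) := by
  split_ifs with h
  · rw [abs_of_nonpos (by omega), enum_neg]
    ring
  · rw [abs_of_nonneg (by omega), mul_one]

/-- The contribution of the principal minor with index set `J`. -/
theorem prod_row_mul_cauchyFactor {τ η : ℂ} {l : ℕ} (hτ : 0 < τ.im)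
    (hη : ∀ j : ℕ, 1 ≤ j → j ≤ 2 * l → ¬ InLattice τ (j * η)) {J : Finset ℕ}
    (hJ : J ⊆ Finset.Icc 1 l) :
    (∏ m ∈ J, ((-1) ^ l * theta τ (2 * m * η) * ∏ j ∈ (Finset.Icc 1 l).erase m,
        enum τ η ((m : ℤ) + j) / enum τ η ((m : ℤ) - j)))
      * (-1) ^ J.card.choose 2
      * ((∏ i ∈ J, ∏ j ∈ J, if i = j then 1 else theta τ (i * η - j * η))
        / ∏ i ∈ J, ∏ j ∈ J, theta τ (i * η + j * η))
      = (-1) ^ (∑ i ∈ J, i) * ∏ k ∈ J, ∏ k' ∈ Finset.Icc 1 l \ J,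
        enum τ η ((k : ℤ) + k') / enum τ η |(k : ℤ) - k'| := by
  have hl : ∀ m ∈ J, 1 ≤ m ∧ m ≤ l := fun m hm => Finset.mem_Icc.1 (hJ hm)
  -- In row m, the factors with j in J cancel against the Cauchy factor, and `θ(2mη)` cancels its
  -- diagonal denominator. Only j outside J survive.
  have key : ∀ m ∈ J, theta τ (2 * m * η) * (∏ j ∈ (Finset.Icc 1 l).erase m,
        enum τ η ((m : ℤ) + j) / enum τ η ((m : ℤ) - j))
      * ((∏ j ∈ J, if m = j then 1 else theta τ (m * η - j * η))
        / ∏ j ∈ J, theta τ (m * η + j * η))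
      = ∏ j ∈ Finset.Icc 1 l \ J, enum τ η ((m : ℤ) + j) / enum τ η ((m : ℤ) - j) := by
    intro m hm
    have hml := hl m hm
    have hθ1 : theta τ η ≠ 0 := by
      simpa using theta_mul_ne_zero hτ hη (j := 1) (by simp) (by omega) (by omega)
    have e0 : (Finset.Icc 1 l).erase m = J.erase m ∪ (Finset.Icc 1 l \ J) := by
      ext j
      have := @hJ j
      by_cases hj : j ∈ J
      · simp_all
      · have hjm : j ≠ m := fun h => hj (h ▸ hm)
        simp [hj, hjm]
    have hdisj : Disjoint (J.erase m) (Finset.Icc 1 l \ J) :=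
      Finset.disjoint_of_subset_left (Finset.erase_subset _ _) Finset.disjoint_sdiff
    have e1 : ∏ j ∈ J, (if m = j then 1 else theta τ (m * η - j * η))
        = ∏ j ∈ J.erase m, theta τ (m * η - j * η) := by
      rw [← Finset.mul_prod_erase J _ hm, if_pos rfl, one_mul]
      exact Finset.prod_congr rfl fun j hj => if_neg (Finset.ne_of_mem_erase hj).symm
    have e2 : ∏ j ∈ J, theta τ (m * η + j * η)
        = theta τ (2 * m * η) * ∏ j ∈ J.erase m, theta τ (m * η + j * η) := by
      rw [← Finset.mul_prod_erase J _ hm]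
      congr 2
      ring
    have e3 : ∏ j ∈ J.erase m, enum τ η ((m : ℤ) + j) / enum τ η ((m : ℤ) - j)
        = (∏ j ∈ J.erase m, theta τ (m * η + j * η)) / ∏ j ∈ J.erase m, theta τ (m * η - j * η) := by
      rw [← Finset.prod_div_distrib]
      refine Finset.prod_congr rfl fun j _ => ?_
      rw [enum_div_enum hθ1]
      push_cast
      rw [add_mul, sub_mul]
    have n0 : theta τ (2 * m * η) ≠ 0 := by
      simpa using theta_mul_ne_zero hτ hη (j := 2 * m) (by omega) (by omega) (by omega)
    have n1 : ∏ j ∈ J.erase m, theta τ (m * η + j * η) ≠ 0 := by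
      refine Finset.prod_ne_zero_iff.2 fun j hj => ?_
      have hjl := hl j (Finset.mem_of_mem_erase hj)
      have := theta_mul_ne_zero hτ hη (j := m + j) (by omega) (by omega) (by omega)
      push_cast at this
      rwa [add_mul] at this
    have n2 : ∏ j ∈ J.erase m, theta τ (m * η - j * η) ≠ 0 := by
      refine Finset.prod_ne_zero_iff.2 fun j hj => ?_
      have hjl := hl j (Finset.mem_of_mem_erase hj)
      have hne := Finset.ne_of_mem_erase hj
      have := theta_mul_ne_zero hτ hη (j := m - j) (by omega) (by omega) (by omega)
      push_cast at this
      rwa [sub_mul] at this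
    rw [e0, Finset.prod_union hdisj, e1, e2, e3]
    generalize ∏ j ∈ J.erase m, theta τ (m * η + j * η) = t1 at *
    generalize ∏ j ∈ J.erase m, theta τ (m * η - j * η) = t2 at *
    generalize ∏ j ∈ Finset.Icc 1 l \ J, enum τ η ((m : ℤ) + j) / enum τ η ((m : ℤ) - j) = t3
    generalize theta τ (2 * m * η) = t4 at *
    field_simp
  have e : ∏ k ∈ J, ∏ k' ∈ Finset.Icc 1 l \ J, enum τ η ((k : ℤ) + k') / enum τ η ((k : ℤ) - k')
      = (∏ k ∈ J, ∏ k' ∈ Finset.Icc 1 l \ J,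
        enum τ η ((k : ℤ) + k') / enum τ η |(k : ℤ) - k'|)
        * ∏ i ∈ J, ∏ j ∈ Finset.Icc 1 l \ J, (if i < j then (-1 : ℂ) else 1) := by
    simp only [← Finset.prod_mul_distrib]
    exact Finset.prod_congr rfl fun i _ => Finset.prod_congr rfl fun j _ =>
      enum_div_enum_abs τ η _ i j
  rw [← sign_identity hJ, ← Finset.prod_div_distrib]
  have hk := Finset.prod_congr rfl key
  rw [e] at hk
  simp only [Finset.prod_mul_distrib] at hk ⊢
  linear_combination ((∏ _i ∈ J, (-1 : ℂ) ^ l) * (-1) ^ J.card.choose 2) * hk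

/-- The embedding `a ↦ a + 1` of `Fin l` into `ℕ`. -/
def succEmb (l : ℕ) : Fin l ↪ ℕ := ⟨fun a => a + 1, fun a b h => Fin.ext (by simpa using h)⟩

@[simp]
theorem succEmb_apply (l : ℕ) (a : Fin l) : succEmb l a = a + 1 := rfl

theorem map_succEmb_univ (l : ℕ) : Finset.univ.map (succEmb l) = Finset.Icc 1 l := by
  ext k
  simp only [Finset.mem_map, Finset.mem_univ, true_and, succEmb_apply, Finset.mem_Icc]
  constructor
  · rintro ⟨a, rfl⟩
    have := a.2
    omega
  · rintro ⟨h1, h2⟩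
    exact ⟨⟨k - 1, by omega⟩, by simp only; omega⟩

theorem sum_powerset_Icc (l : ℕ) (f : Finset ℕ → ℂ) :
    ∑ J ∈ (Finset.Icc 1 l).powerset, f J = ∑ s : Finset (Fin l), f (s.map (succEmb l)) := by
  rw [← map_succEmb_univ]
  symm
  refine Finset.sum_bij (fun s _ => s.map (succEmb l)) ?_ ?_ ?_ ?_
  · intro s _
    exact Finset.mem_powerset.2 (Finset.map_subset_map.2 (Finset.subset_univ s))
  · intro s _ t _ h
    exact Finset.map_injective _ h
  · intro J hJ
    obtain ⟨s, _, rfl⟩ := Finset.subset_map_iff.1 (Finset.mem_powerset.1 hJ)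
    exact ⟨s, Finset.mem_univ s, rfl⟩
  · intro s _
    rfl

theorem sum_Icc_eq_bigN (l : ℕ) : ∑ k ∈ Finset.Icc 1 l, k = bigN l := by
  have h := Finset.sum_range_id_mul_two (l + 1)
  have h2 : ∑ k ∈ Finset.Icc 1 l, k = ∑ k ∈ Finset.range (l + 1), k := by
    rw [Finset.range_eq_Ico, Finset.sum_eq_sum_Ico_succ_bot (by omega)]
    simp [Finset.Ico_add_one_right_eq_Icc]
  rw [bigN, h2]
  have h3 : (l + 1) * (l + 1 - 1) = l * (l + 1) := by simp [mul_comm]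
  omega

theorem sum_le_bigN {l : ℕ} {J : Finset ℕ} (hJ : J ⊆ Finset.Icc 1 l) : ∑ k ∈ J, k ≤ bigN l := by
  rw [← sum_Icc_eq_bigN]
  exact Finset.sum_le_sum_of_subset hJ

theorem sum_sdiff_eq {l : ℕ} {J : Finset ℕ} (hJ : J ⊆ Finset.Icc 1 l) :
    ∑ k ∈ Finset.Icc 1 l \ J, k = bigN l - ∑ k ∈ J, k := by
  have := Finset.sum_sdiff (f := fun k => k) hJ
  rw [sum_Icc_eq_bigN] at this
  omega

/-- Extracting a factor from each row turns the principal minor into an elliptic Cauchy determinant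
with parameters kη. -/
theorem det_minor {τ η : ℂ} {l : ℕ} (hτ : 0 < τ.im)
    (hη : ∀ j : ℕ, 1 ≤ j → j ≤ 2 * l → ¬ InLattice τ (j * η)) {ζ : ℂ} (hζ : theta τ ζ ≠ 0)
    (s : Finset (Fin l)) :
    theta τ ζ * ((Matrix.of fun a b : Fin l => entryG τ η l ζ ((a : ℕ) + 1)
        ((b : ℕ) + 1)).submatrix (Subtype.val : s → Fin l) (Subtype.val : s → Fin l)).det
      = (-1) ^ (∑ k ∈ s.map (succEmb l), k)
        * (∏ k ∈ s.map (succEmb l), ∏ k' ∈ Finset.Icc 1 l \ s.map (succEmb l),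
          enum τ η ((k : ℤ) + k') / enum τ η |(k : ℤ) - k'|)
        * theta τ (ζ - 2 * (∑ k ∈ s.map (succEmb l), k : ℕ) * η) := by
  have hJ : s.map (succEmb l) ⊆ Finset.Icc 1 l := by
    rw [← map_succEmb_univ]
    exact Finset.map_subset_map.2 (Finset.subset_univ s)
  rw [← prod_row_mul_cauchyFactor hτ hη hJ]
  set a : s → ℂ := fun i => ((succEmb l i : ℕ) : ℂ) * η with ha
  -- The sign `(-1)^(l+1)` of `entryG` becomes `(-1)^l` because the denominator `θ(-(m+n)η)` of Φ is
  -- replaced by `θ((m+n)η)`.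
  set g : ℕ → ℂ := fun m => (-1) ^ l * theta τ (2 * m * η) * ∏ j ∈ (Finset.Icc 1 l).erase m,
        enum τ η ((m : ℤ) + j) / enum τ η ((m : ℤ) - j) with hg
  have hM : ((Matrix.of fun a b : Fin l => entryG τ η l ζ ((a : ℕ) + 1)
        ((b : ℕ) + 1)).submatrix (Subtype.val : s → Fin l) (Subtype.val : s → Fin l))
      = Matrix.of fun i j : s => (g (succEmb l i) * (theta τ ζ)⁻¹) * cauchyTheta τ ζ a i j := by
    ext i j
    have : -(((((i : Fin l) : ℕ) + 1 : ℕ) : ℂ) + ((((j : Fin l) : ℕ) + 1 : ℕ) : ℂ)) * η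
        = -(a i + a j) := by
      simp only [ha, succEmb_apply]
      ring
    simp only [Matrix.submatrix_apply, Matrix.of_apply, entryG, Phi, hg, cauchyTheta]
    rw [← neg_mul, this, theta_neg, show ζ + -(a i + a j) = ζ - a i - a j by ring, pow_succ]
    simp only [succEmb_apply]
    generalize theta τ (a i + a j) = t
    rw [neg_mul, div_neg, div_mul_eq_div_div, div_eq_mul_inv _ (theta τ ζ)]
    ring
  have hadd : ∀ i j : s, theta τ (a i + a j) ≠ 0 := by
    intro i j
    have := theta_mul_ne_zero hτ hη (j := (succEmb l i : ℕ) + (succEmb l j : ℕ))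
      (by simp only [succEmb_apply]; omega) (by omega) (by
        have := i.1.2
        have := j.1.2
        simp only [succEmb_apply]; omega)
    push_cast at this
    rwa [add_mul] at this
  have hdet := det_cauchyTheta hτ s a hadd ζ
  have hsum : ∑ i, a i = (∑ k ∈ s.map (succEmb l), k : ℕ) * η := by
    simp only [ha, ← Finset.sum_mul]
    congr 1
    rw [Finset.sum_map, Finset.sum_coe_sort s (fun i => ((succEmb l i : ℕ) : ℂ))]
    push_cast
    rfl
  have hcf : cauchyFactor τ a = (∏ i ∈ s.map (succEmb l), ∏ j ∈ s.map (succEmb l),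
      if i = j then 1 else theta τ (i * η - j * η))
        / ∏ i ∈ s.map (succEmb l), ∏ j ∈ s.map (succEmb l), theta τ (i * η + j * η) := by
    unfold cauchyFactor
    simp only [Finset.prod_map]
    congr 1
    · rw [← Finset.prod_coe_sort s]
      refine Finset.prod_congr rfl fun i _ => ?_
      rw [← Finset.prod_coe_sort s]
      refine Finset.prod_congr rfl fun j _ => ?_
      simp only [ha, succEmb_apply, Subtype.ext_iff, Fin.ext_iff, add_left_inj]
    · rw [← Finset.prod_coe_sort s]
      refine Finset.prod_congr rfl fun i _ => ?_
      rw [← Finset.prod_coe_sort s]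
  rw [hM, Matrix.det_mul_column, ← hcf, Finset.prod_mul_distrib, Finset.prod_const,
    Finset.card_univ, Finset.card_map, Finset.prod_map, Finset.prod_coe_sort s
      (fun i => g (succEmb l i)), mul_assoc 2, ← hsum]
  rw [Fintype.card_coe] at hdet ⊢
  have hz := pow_ne_zero s.card hζ
  rw [inv_pow]
  field_simp
  linear_combination (∏ i ∈ s, g (succEmb l i)) * hdet

theorem theta_mul_det_multMatrix {τ η : ℂ} {l : ℕ} (hτ : 0 < τ.im)
    (hη : ∀ j : ℕ, 1 ≤ j → j ≤ 2 * l → ¬ InLattice τ (j * η)) {ζ : ℂ} (hζ : theta τ ζ ≠ 0)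
    (K : ℂ) : theta τ ζ * (multMatrix τ η l ζ K).det = relationSum τ η l ζ K := by
  have hM : multMatrix τ η l ζ K = Matrix.diagonal (fun a : Fin l => K ^ (2 * ((a : ℕ) + 1)))
      + Matrix.of fun a b : Fin l => entryG τ η l ζ ((a : ℕ) + 1) ((b : ℕ) + 1) := by
    ext a b
    simp [multMatrix, Matrix.diagonal_apply]
  have hR : relationSum τ η l ζ K = ∑ J ∈ (Finset.Icc 1 l).powerset, (-1) ^ (∑ k ∈ J, k)
        * (∏ k ∈ J, ∏ k' ∈ Finset.Icc 1 l \ J,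
          enum τ η ((k : ℤ) + k') / enum τ η |(k : ℤ) - k'|)
        * theta τ (ζ - 2 * (∑ k ∈ J, k : ℕ) * η) * K ^ (2 * (bigN l - ∑ k ∈ J, k)) := by
    -- The sum over subsets is grouped by the element sum, which is the index of `coeffC`.
    rw [← Finset.sum_fiberwise_of_maps_to (t := Finset.range (bigN l + 1))
      (g := fun J => ∑ k ∈ J, k) (fun J hJ => Finset.mem_range.2
        (Nat.lt_succ_of_le (sum_le_bigN (Finset.mem_powerset.1 hJ))))]
    refine Finset.sum_congr rfl fun j _ => ?_
    rw [coeffC, Finset.mul_sum, Finset.sum_mul, Finset.sum_mul]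
    refine Finset.sum_congr rfl fun J hJ => ?_
    rw [(Finset.mem_filter.1 hJ).2]
  rw [hM, det_diagonal_add, hR, sum_powerset_Icc, Finset.mul_sum]
  refine Finset.sum_congr rfl fun s _ => ?_
  rw [mul_left_comm, det_minor hτ hη hζ, mul_comm]
  congr 1
  have hJ : s.map (succEmb l) ⊆ Finset.Icc 1 l := by
    rw [← map_succEmb_univ]
    exact Finset.map_subset_map.2 (Finset.subset_univ s)
  rw [← sum_sdiff_eq hJ, ← map_succEmb_univ, ← Finset.map_sdiff, Finset.sum_map,
    ← Finset.compl_eq_univ_sdiff, Finset.prod_pow_eq_pow_sum, Finset.mul_sum]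
  rfl

/-! ### The coefficients of the relation -/

theorem coeffC_zero (τ η : ℂ) (l : ℕ) : coeffC τ η l 0 = 1 := by
  have : (Finset.Icc 1 l).powerset.filter (fun J => ∑ k ∈ J, k = 0) = {∅} := by
    ext J
    simp only [Finset.mem_filter, Finset.mem_powerset, Finset.mem_singleton, Finset.sum_eq_zero_iff]
    constructor
    · rintro ⟨h1, h2⟩
      refine Finset.eq_empty_of_forall_notMem fun k hk => ?_
      have := Finset.mem_Icc.1 (h1 hk)
      have := h2 k hk
      omega
    · rintro rfl
      simp
  rw [coeffC, this]
  simp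

/-- Complementation in {1, …, ℓ} exchanges the sums j and N - j, and the weight is symmetric in k
and k'. -/
theorem coeffC_symm (τ η : ℂ) {l j : ℕ} (hj : j ≤ bigN l) :
    coeffC τ η l j = coeffC τ η l (bigN l - j) := by
  refine Finset.sum_nbij' (fun J => Finset.Icc 1 l \ J) (fun J => Finset.Icc 1 l \ J) ?_ ?_ ?_ ?_ ?_
  · intro J hJ
    rw [Finset.mem_filter, Finset.mem_powerset] at hJ ⊢
    exact ⟨Finset.sdiff_subset, by rw [sum_sdiff_eq hJ.1, hJ.2]⟩
  · intro J hJ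
    rw [Finset.mem_filter, Finset.mem_powerset] at hJ ⊢
    exact ⟨Finset.sdiff_subset, by rw [sum_sdiff_eq hJ.1, hJ.2]; omega⟩
  · intro J hJ
    rw [Finset.mem_filter, Finset.mem_powerset] at hJ
    exact Finset.sdiff_sdiff_eq_self hJ.1
  · intro J hJ
    rw [Finset.mem_filter, Finset.mem_powerset] at hJ
    exact Finset.sdiff_sdiff_eq_self hJ.1
  · intro J hJ
    rw [Finset.mem_filter, Finset.mem_powerset] at hJ
    rw [Finset.sdiff_sdiff_eq_self hJ.1, Finset.prod_comm]
    refine Finset.prod_congr rfl fun k _ => Finset.prod_congr rfl fun k' _ => ?_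
    rw [add_comm, abs_sub_comm]

/-! ### Symmetry of entire solutions -/

/-- The equations at jη and -jη exchange their two terms because θ is odd. Symmetry at j - 1 and j
therefore gives symmetry at j + 1, whose coefficient `θ((j-ℓ)η)` is nonzero for j < ℓ. No regularity
of Ψ is involved once the equation holds everywhere. -/
theorem symm_of_diffEq {τ η : ℂ} {l : ℕ} (hτ : 0 < τ.im)
    (hη : ∀ j : ℕ, 1 ≤ j → j ≤ 2 * l → ¬ InLattice τ (j * η)) {E : ℂ} {Ψ : ℂ → ℂ}
    (h : ∀ x, theta τ (x - l * η) * Ψ (x + η) + theta τ (x + l * η) * Ψ (x - η)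
      = E * theta τ x * Ψ x) (j : ℕ) (hj : j ≤ l) : Ψ (j * η) = Ψ (-(j * η)) := by
  induction j using Nat.strong_induction_on with
  | _ j ih =>
    match j with
    | 0 => simp
    | j + 1 =>
      have h1 := h (j * η)
      have h2 := h (-(j * η))
      rw [show (j : ℂ) * η - l * η = ((j - l : ℤ) : ℂ) * η by push_cast; ring,
        show (j : ℂ) * η + l * η = ((j + l : ℤ) : ℂ) * η by push_cast; ring,
        show (j : ℂ) * η + η = ((j + 1 : ℕ) : ℂ) * η by push_cast; ring] at h1
      rw [show -((j : ℂ) * η) - l * η = -(((j + l : ℤ) : ℂ) * η) by push_cast; ring,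
        show -((j : ℂ) * η) + l * η = -(((j - l : ℤ) : ℂ) * η) by push_cast; ring,
        show -((j : ℂ) * η) - η = -(((j + 1 : ℕ) : ℂ) * η) by push_cast; ring,
        theta_neg, theta_neg, theta_neg, ← ih j (by omega) (by omega)] at h2
      have hne : theta τ (((j - l : ℤ) : ℂ) * η) ≠ 0 :=
        theta_mul_ne_zero hτ hη (by omega) (by omega) (by omega)
      -- For j = 0 there is no earlier case to use; the equation at 0, where `θ(0) = 0`, gives the
      -- claim directly.
      have h3 : theta τ (((j + l : ℤ) : ℂ) * η) * Ψ (j * η - η)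
          = theta τ (((j + l : ℤ) : ℂ) * η) * Ψ (-(j * η) + η) := by
        rcases Nat.eq_zero_or_pos j with h0 | h0
        · subst h0
          have h0 := h 0
          simp only [zero_sub, zero_add, theta_neg, theta_zero, mul_zero, zero_mul] at h0
          simp only [Nat.cast_zero, zero_mul, zero_sub, neg_zero, zero_add, Int.cast_natCast]
          linear_combination h0
        · have e := ih (j - 1) (by omega) (by omega)
          rw [Nat.cast_sub h0, Nat.cast_one] at e
          rw [show (j : ℂ) * η - η = (j - 1) * η by ring, e,
            show -(((j : ℂ) - 1) * η) = -(j * η) + η by ring]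
      apply mul_left_cancel₀ hne
      linear_combination h1 + h2 - h3

theorem diffEq_of_off_lattice {τ η : ℂ} {l : ℕ} (hτ : 0 < τ.im) {E : ℂ} {Ψ : ℂ → ℂ}
    (hΨ : Differentiable ℂ Ψ) (h : ∀ x, ¬ InLattice τ x →
      theta τ (x - l * η) / theta τ x * Ψ (x + η) + theta τ (x + l * η) / theta τ x * Ψ (x - η)
        = E * Ψ x) (x : ℂ) : theta τ (x - l * η) * Ψ (x + η) + theta τ (x + l * η) * Ψ (x - η)
      = E * theta τ x * Ψ x := by
  have hθ := differentiable_theta hτ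
  have h1 : Differentiable ℂ fun x => theta τ (x - l * η) := hθ.comp (by fun_prop)
  have h2 : Differentiable ℂ fun x => theta τ (x + l * η) := hθ.comp (by fun_prop)
  rw [← sub_eq_zero]
  refine eq_zero_of_mul_eq_zero_of_differentiable (F := fun x => theta τ (x - l * η) * Ψ (x + η)
    + theta τ (x + l * η) * Ψ (x - η) - E * theta τ x * Ψ x) (by fun_prop) hθ
    (exists_theta_ne_zero hτ) (fun y => ?_) x
  by_cases hy : theta τ y = 0
  · rw [hy, zero_mul]
  · have e := h y fun hL => hy ((theta_eq_zero_iff hτ).2 hL)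
    rw [div_mul_eq_mul_div, div_mul_eq_mul_div, ← add_div, div_eq_iff hy] at e
    rw [e]
    ring

/-! ### The double-Bloch ansatz -/

/-- The ansatz without the exponential factor and with the denominators cleared. -/
def psi (τ η : ℂ) (l : ℕ) (ζ : ℂ) (s : ℕ → ℂ) (x : ℂ) : ℂ :=
  ∑ j ∈ Finset.Icc 1 l, s j * (theta τ (ζ + x - j * η)
    * ∏ k ∈ (Finset.Icc 1 l).erase j, theta τ (x - k * η))

/-- The multiplier of the theta function under translation by `τ`. -/
def tauMul (τ x : ℂ) : ℂ := -exp (-(Real.pi * I * τ + 2 * Real.pi * I * x))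

theorem tauMul_add (τ x y : ℂ) :
    tauMul τ (x + y) = tauMul τ x * exp (-(2 * Real.pi * I * y)) := by
  rw [tauMul, tauMul, neg_mul, ← exp_add]
  congr 2
  ring

theorem differentiable_psi {τ : ℂ} (hτ : 0 < τ.im) (η : ℂ) (l : ℕ) (ζ : ℂ) (s : ℕ → ℂ) :
    Differentiable ℂ (psi τ η l ζ s) := by
  have hθ := differentiable_theta hτ
  unfold psi
  refine Differentiable.fun_sum fun j _ => Differentiable.const_mul (Differentiable.mul ?_ ?_) _
  · exact hθ.comp (by fun_prop)
  · exact Differentiable.fun_finsetProd fun k _ => hθ.comp (by fun_prop)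

theorem psi_add_one (τ η : ℂ) (l : ℕ) (ζ : ℂ) (s : ℕ → ℂ) (x : ℂ) :
    psi τ η l ζ s (x + 1) = (-1) ^ l * psi τ η l ζ s x := by
  rw [psi, psi, Finset.mul_sum]
  refine Finset.sum_congr rfl fun j hj => ?_
  have h1 : ∏ k ∈ (Finset.Icc 1 l).erase j, theta τ (x + 1 - k * η)
      = (∏ k ∈ (Finset.Icc 1 l).erase j, (-1)) * ∏ k ∈ (Finset.Icc 1 l).erase j,
        theta τ (x - k * η) := by
    rw [← Finset.prod_mul_distrib]
    refine Finset.prod_congr rfl fun k _ => ?_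
    rw [add_sub_right_comm, theta_add_one, neg_one_mul]
  have h2 : (-1 : ℂ) * (∏ k ∈ (Finset.Icc 1 l).erase j, (-1)) = (-1) ^ l := by
    rw [Finset.mul_prod_erase (Finset.Icc 1 l) (fun _ => (-1 : ℂ)) hj]
    simp
  rw [h1, ← add_assoc, add_sub_right_comm, theta_add_one, ← h2]
  ring

theorem psi_add_tau (τ η : ℂ) (l : ℕ) (ζ : ℂ) (s : ℕ → ℂ) (x : ℂ) :
    psi τ η l ζ s (x + τ) = exp (-(2 * Real.pi * I * ζ))
      * (∏ k ∈ Finset.Icc 1 l, tauMul τ (x - k * η)) * psi τ η l ζ s x := by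
  rw [psi, psi, Finset.mul_sum]
  refine Finset.sum_congr rfl fun j hj => ?_
  have h1 : ∏ k ∈ (Finset.Icc 1 l).erase j, theta τ (x + τ - k * η)
      = (∏ k ∈ (Finset.Icc 1 l).erase j, tauMul τ (x - k * η)) * ∏ k ∈ (Finset.Icc 1 l).erase j,
        theta τ (x - k * η) := by
    rw [← Finset.prod_mul_distrib]
    refine Finset.prod_congr rfl fun k _ => ?_
    rw [add_sub_right_comm, theta_add_tau, tauMul]
  have h2 : theta τ (ζ + (x + τ) - j * η)
      = tauMul τ (x - j * η) * exp (-(2 * Real.pi * I * ζ)) * theta τ (ζ + x - j * η) := by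
    rw [← tauMul_add, ← add_assoc, add_sub_right_comm, theta_add_tau, tauMul]
    congr 5
    ring
  rw [h1, h2, ← Finset.mul_prod_erase (Finset.Icc 1 l) _ hj]
  ring

theorem psi_smul (τ η : ℂ) (l : ℕ) (ζ c : ℂ) (s : ℕ → ℂ) (x : ℂ) :
    psi τ η l ζ (fun j => c * s j) x = c * psi τ η l ζ s x := by
  rw [psi, psi, Finset.mul_sum]
  exact Finset.sum_congr rfl fun j _ => by ring

/-- The value at `jη` of the `j`-th basis function. -/
def basisVal (τ η : ℂ) (l : ℕ) (ζ : ℂ) (j : ℕ) : ℂ :=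
  theta τ ζ * ∏ k ∈ (Finset.Icc 1 l).erase j, theta τ (j * η - k * η)

/-- The summands are Lagrange interpolants: every one except the j-th contains the factor `θ(x -
jη)`. Coefficients and values at η, …, ℓη thus determine each other when no `basisVal` vanishes. -/
theorem psi_apply_mul (τ η : ℂ) {l : ℕ} (ζ : ℂ) (s : ℕ → ℂ) {j : ℕ} (hj : j ∈ Finset.Icc 1 l) :
    psi τ η l ζ s (j * η) = s j * basisVal τ η l ζ j := by
  rw [psi, Finset.sum_eq_single_of_mem j hj, basisVal, add_sub_cancel_right]
  intro i _ hij
  rw [Finset.prod_eq_zero (Finset.mem_erase.2 ⟨hij.symm, hj⟩)]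
  · simp
  · simp

theorem theta_sub_mul_ne_zero {τ η : ℂ} {l : ℕ} (hτ : 0 < τ.im)
    (hη : ∀ j : ℕ, 1 ≤ j → j ≤ 2 * l → ¬ InLattice τ (j * η)) {i j : ℕ} (hi : i ≤ l) (hj : j ≤ l)
    (hij : i ≠ j) : theta τ (i * η - j * η) ≠ 0 := by
  have := theta_mul_ne_zero hτ hη (j := i - j) (by omega) (by omega) (by omega)
  push_cast at this
  rwa [sub_mul] at this

theorem basisVal_ne_zero {τ η : ℂ} {l : ℕ} (hτ : 0 < τ.im)
    (hη : ∀ j : ℕ, 1 ≤ j → j ≤ 2 * l → ¬ InLattice τ (j * η)) {ζ : ℂ} (hζ : theta τ ζ ≠ 0)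
    {j : ℕ} (hj : j ∈ Finset.Icc 1 l) : basisVal τ η l ζ j ≠ 0 := by
  refine mul_ne_zero hζ (Finset.prod_ne_zero_iff.2 fun k hk => ?_)
  have hk' := Finset.mem_Icc.1 (Finset.mem_of_mem_erase hk)
  exact theta_sub_mul_ne_zero hτ hη (Finset.mem_Icc.1 hj).2 hk'.2 (Finset.ne_of_mem_erase hk).symm

theorem prod_Icc_eq_prod_range {R : Type*} [CommMonoid R] (l : ℕ) (f : ℕ → R) :
    ∏ k ∈ Finset.Icc 1 l, f k = ∏ k ∈ Finset.range l, f (k + 1) := by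
  induction l with
  | zero => simp
  | succ n ih => rw [Finset.prod_Icc_succ_top (by omega), ih, Finset.prod_range_succ]

theorem prod_range_succ_eq_mul_Icc {R : Type*} [CommMonoid R] (l : ℕ) (f : ℕ → R) :
    ∏ k ∈ Finset.range (l + 1), f k = f 0 * ∏ k ∈ Finset.Icc 1 l, f k := by
  rw [Finset.prod_range_succ', prod_Icc_eq_prod_range, mul_comm]

/-- Both sides of the difference equation are theta functions of degree `l + 1`, so it suffices to
test it at `l + 1` points. -/
theorem diffEq_of_values {τ η : ℂ} {l : ℕ} (hτ : 0 < τ.im)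
    (hη : ∀ j : ℕ, 1 ≤ j → j ≤ 2 * l → ¬ InLattice τ (j * η)) {ζ : ℂ} (hζ : ¬ InLattice τ ζ)
    (K : ℂ) (u v : ℕ → ℂ)
    (h : ∀ m ∈ Finset.range (l + 1), K * theta τ (m * η - l * η) * psi τ η l ζ v (m * η + η)
      + K⁻¹ * theta τ (m * η + l * η) * psi τ η l ζ v (m * η - η)
      = theta τ (m * η) * psi τ η l ζ u (m * η)) (x : ℂ) :
    K * theta τ (x - l * η) * psi τ η l ζ v (x + η)
      + K⁻¹ * theta τ (x + l * η) * psi τ η l ζ v (x - η) = theta τ x * psi τ η l ζ u x := by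
  have hθ := differentiable_theta hτ
  have hv := differentiable_psi hτ η l ζ v
  have hu := differentiable_psi hτ η l ζ u
  rw [← sub_eq_zero]
  refine eq_zero_of_theta_multipliers (F := fun x => K * theta τ (x - l * η)
    * psi τ η l ζ v (x + η) + K⁻¹ * theta τ (x + l * η) * psi τ η l ζ v (x - η)
    - theta τ x * psi τ η l ζ u x) hτ hζ (Finset.range (l + 1)) (fun m : ℕ => (m : ℂ) * η)
    ?_ ?_ ?_ ?_ ?_ x
  · intro i hi j hj hij
    exact theta_sub_mul_ne_zero hτ hη (by simp at hi; omega) (by simp at hj; omega) hij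
  · have h1 : Differentiable ℂ fun x => theta τ (x - l * η) := hθ.comp (by fun_prop)
    have h2 : Differentiable ℂ fun x => theta τ (x + l * η) := hθ.comp (by fun_prop)
    have h3 : Differentiable ℂ fun x => psi τ η l ζ v (x + η) := hv.comp (by fun_prop)
    have h4 : Differentiable ℂ fun x => psi τ η l ζ v (x - η) := hv.comp (by fun_prop)
    fun_prop
  · intro x
    simp only [add_sub_right_comm x 1, add_right_comm x 1, theta_add_one, psi_add_one,
      Finset.card_range, pow_succ]
    ring
  · intro x
    have e : ∏ i ∈ Finset.range (l + 1), -exp (-(Real.pi * I * τ + 2 * Real.pi * I * (x - i * η)))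
        = tauMul τ x * ∏ k ∈ Finset.Icc 1 l, tauMul τ (x - k * η) := by
      rw [prod_range_succ_eq_mul_Icc]
      simp [tauMul]
    have hp : ∀ c : ℂ, ∏ k ∈ Finset.Icc 1 l, tauMul τ (x + c - k * η)
        = (∏ k ∈ Finset.Icc 1 l, tauMul τ (x - k * η)) * exp (-(2 * Real.pi * I * c)) ^ l := by
      intro c
      have : ∏ _k ∈ Finset.Icc 1 l, exp (-(2 * Real.pi * I * c))
        = exp (-(2 * Real.pi * I * c)) ^ l := by simp
      rw [← this, ← Finset.prod_mul_distrib]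
      refine Finset.prod_congr rfl fun k _ => ?_
      rw [← tauMul_add]
      congr 1
      ring
    have ht : ∀ y, theta τ (y + τ) = tauMul τ y * theta τ y := theta_add_tau τ
    -- A shift of `psi` by ±η affects all l of its multiplier factors, and the shift of θ by ∓lη
    -- compensates exactly. This is why the three terms share a multiplier.
    have hc1 : exp (-(2 * Real.pi * I * (-(l * η)))) * exp (-(2 * Real.pi * I * η)) ^ l = 1 := by
      rw [← exp_nat_mul, ← exp_add, ← exp_zero]
      congr 1
      ring
    have hc2 : exp (-(2 * Real.pi * I * (l * η))) * exp (-(2 * Real.pi * I * (-η))) ^ l = 1 := by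
      rw [← exp_nat_mul, ← exp_add, ← exp_zero]
      congr 1
      ring
    rw [e]
    simp only [add_sub_right_comm x τ, add_right_comm x τ, ht, psi_add_tau, hp]
    rw [sub_eq_add_neg x (l * η), sub_eq_add_neg x η, hp, tauMul_add, tauMul_add]
    generalize ∏ k ∈ Finset.Icc 1 l, tauMul τ (x - k * η) = P
    linear_combination (K * tauMul τ x * theta τ (x + -(l * η)) * exp (-(2 * Real.pi * I * ζ)) * P
        * psi τ η l ζ v (x + η)) * hc1
      + (K⁻¹ * tauMul τ x * theta τ (x + l * η) * exp (-(2 * Real.pi * I * ζ)) * P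
        * psi τ η l ζ v (x + -η)) * hc2
  · intro m hm
    exact sub_eq_zero.2 (h m hm)

/-- The difference equation for the ansatz, with denominators cleared, at the point `x`. -/
def BlochEqAt (τ η : ℂ) (l : ℕ) (ζ K E : ℂ) (s : ℕ → ℂ) (x : ℂ) : Prop :=
  K * theta τ (x - l * η) * psi τ η l ζ s (x + η)
    + K⁻¹ * theta τ (x + l * η) * psi τ η l ζ s (x - η) = E * theta τ x * psi τ η l ζ s x

theorem blochEqAt_of_values {τ η : ℂ} {l : ℕ} (hτ : 0 < τ.im)
    (hη : ∀ j : ℕ, 1 ≤ j → j ≤ 2 * l → ¬ InLattice τ (j * η)) {ζ : ℂ} (hζ : ¬ InLattice τ ζ)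
    {K E : ℂ} {s : ℕ → ℂ} (h : ∀ m ∈ Finset.range (l + 1), BlochEqAt τ η l ζ K E s (m * η))
    (x : ℂ) : BlochEqAt τ η l ζ K E s x := by
  have := diffEq_of_values hτ hη hζ K (fun j => E * s j) s (fun m hm => by
    rw [psi_smul, h m hm]; ring) x
  rw [psi_smul] at this
  rw [BlochEqAt, this]
  ring

theorem ansatz_eq {τ η : ℂ} {l : ℕ} {ζ : ℂ} (K : ℂ) (s : ℕ → ℂ) {x : ℂ}
    (hx : ∏ k ∈ Finset.Icc 1 l, theta τ (x - k * η) ≠ 0) :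
    ansatz τ η l ζ K s x = K ^ (x / η) * psi τ η l ζ s x
      / (theta τ ζ * ∏ k ∈ Finset.Icc 1 l, theta τ (x - k * η)) := by
  rw [ansatz, psi, mul_div_assoc, Finset.sum_div]
  congr 1
  refine Finset.sum_congr rfl fun j hj => ?_
  have h2 := Finset.mul_prod_erase (Finset.Icc 1 l) (fun k : ℕ => theta τ (x - k * η)) hj
  rw [← h2] at hx ⊢
  have hx2 := right_ne_zero_of_mul hx
  rw [Phi, ← add_sub_assoc, ← mul_assoc (theta τ ζ), ← mul_assoc (s j), mul_div_mul_right _ _ hx2,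
    mul_div_assoc, mul_comm (theta τ ζ)]

/-- The products of `θ(x ± η - kη)` telescope against the coefficient of the Lamé equation, so the
two equations differ by the nonvanishing factor `K^{x/η} / (θ(ζ) θ(x) ∏ θ(x - kη))`. -/
theorem lameEqAt_ansatz_iff {τ η : ℂ} {l : ℕ} (hη : η ≠ 0) {ζ K : ℂ} (hζ : theta τ ζ ≠ 0)
    (hK : K ≠ 0) (E : ℂ) (s : ℕ → ℂ) {x : ℂ}
    (hx : ∀ j ∈ Finset.range (l + 2), theta τ (x - j * η) ≠ 0) :
    LameEqAt τ η l E (ansatz τ η l ζ K s) x ↔ BlochEqAt τ η l ζ K E s x := by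
  have hP : ∏ k ∈ Finset.Icc 1 l, theta τ (x - k * η) ≠ 0 :=
    Finset.prod_ne_zero_iff.2 fun k hk => hx k (by simp at hk ⊢; omega)
  have e1 : (∏ k ∈ Finset.Icc 1 l, theta τ (x + η - k * η)) * theta τ (x - l * η)
      = theta τ x * ∏ k ∈ Finset.Icc 1 l, theta τ (x - k * η) := by
    have := prod_range_succ_eq_mul_Icc l (fun k : ℕ => theta τ (x - k * η))
    rw [Finset.prod_range_succ] at this
    simp only [Nat.cast_zero, zero_mul, sub_zero] at this
    rw [← this, prod_Icc_eq_prod_range]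
    congr 1
    refine Finset.prod_congr rfl fun k _ => ?_
    congr 1
    push_cast
    ring
  have e2 : theta τ (x - η) * (∏ k ∈ Finset.Icc 1 l, theta τ (x - η - k * η))
      = (∏ k ∈ Finset.Icc 1 l, theta τ (x - k * η)) * theta τ (x - (l + 1) * η) := by
    have := prod_range_succ_eq_mul_Icc l (fun k : ℕ => theta τ (x - (k + 1) * η))
    rw [Finset.prod_range_succ] at this
    simp only [Nat.cast_zero, zero_add, one_mul] at this
    rw [prod_Icc_eq_prod_range l (fun k : ℕ => theta τ (x - k * η))]
    push_cast
    rw [this]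
    congr 1
    refine Finset.prod_congr rfl fun k _ => ?_
    congr 1
    ring
  have n0 : theta τ x ≠ 0 := by simpa using hx 0 (by simp)
  have n1 : theta τ (x - η) ≠ 0 := by
    rcases Nat.eq_zero_or_pos l with h | h
    · subst h
      simpa using hx 1 (by simp)
    · simpa using hx 1 (by simp)
  have n2 : theta τ (x - (l + 1) * η) ≠ 0 := by
    have := hx (l + 1) (by simp)
    push_cast at this
    exact this
  have n3 : theta τ (x - l * η) ≠ 0 := hx l (by simp)
  have hP1 : ∏ k ∈ Finset.Icc 1 l, theta τ (x + η - k * η) ≠ 0 := by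
    refine left_ne_zero_of_mul (b := theta τ (x - l * η)) ?_
    rw [e1]
    exact mul_ne_zero n0 hP
  have hP2 : ∏ k ∈ Finset.Icc 1 l, theta τ (x - η - k * η) ≠ 0 := by
    refine right_ne_zero_of_mul (a := theta τ (x - η)) ?_
    rw [e2]
    exact mul_ne_zero hP n2
  have hW : K ^ (x / η) ≠ 0 := by simp [cpow_eq_zero_iff, hK]
  have w1 : K ^ ((x + η) / η) = K ^ (x / η) * K := by
    rw [add_div, div_self hη, cpow_add _ _ hK, cpow_one]
  have w2 : K ^ ((x - η) / η) = K ^ (x / η) * K⁻¹ := by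
    rw [sub_div, div_self hη, cpow_sub _ _ hK, cpow_one, div_eq_mul_inv]
  have i1 : (∏ k ∈ Finset.Icc 1 l, theta τ (x + η - k * η))⁻¹
      = theta τ (x - l * η) / (theta τ x * ∏ k ∈ Finset.Icc 1 l, theta τ (x - k * η)) := by
    rw [eq_div_iff (mul_ne_zero n0 hP), ← e1, inv_mul_cancel_left₀ hP1]
  have i2 : (∏ k ∈ Finset.Icc 1 l, theta τ (x - η - k * η))⁻¹
      = theta τ (x - η) / ((∏ k ∈ Finset.Icc 1 l, theta τ (x - k * η))
        * theta τ (x - (l + 1) * η)) := by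
    rw [← e2]
    field_simp
  rw [LameEqAt, BlochEqAt, ansatz_eq K s hP, ansatz_eq K s hP1, ansatz_eq K s hP2, w1, w2]
  have key : K ^ (x / η) * K * psi τ η l ζ s (x + η)
        / (theta τ ζ * ∏ k ∈ Finset.Icc 1 l, theta τ (x + η - k * η))
      + theta τ (x + l * η) * theta τ (x - (l + 1) * η) / (theta τ x * theta τ (x - η))
        * (K ^ (x / η) * K⁻¹ * psi τ η l ζ s (x - η)
          / (theta τ ζ * ∏ k ∈ Finset.Icc 1 l, theta τ (x - η - k * η)))
      - E * (K ^ (x / η) * psi τ η l ζ s x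
        / (theta τ ζ * ∏ k ∈ Finset.Icc 1 l, theta τ (x - k * η)))
      = (K ^ (x / η) / (theta τ ζ * theta τ x * ∏ k ∈ Finset.Icc 1 l, theta τ (x - k * η)))
        * (K * theta τ (x - l * η) * psi τ η l ζ s (x + η)
          + K⁻¹ * theta τ (x + l * η) * psi τ η l ζ s (x - η)
          - E * theta τ x * psi τ η l ζ s x) := by
    rw [div_mul_eq_div_div_swap, div_eq_mul_inv _ (∏ k ∈ Finset.Icc 1 l, theta τ (x + η - k * η)),
      div_mul_eq_div_div_swap _ _ (∏ k ∈ Finset.Icc 1 l, theta τ (x - η - k * η)),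
      div_eq_mul_inv _ (∏ k ∈ Finset.Icc 1 l, theta τ (x - η - k * η)), i1, i2]
    generalize ∏ k ∈ Finset.Icc 1 l, theta τ (x - k * η) = P at *
    generalize theta τ (x - (l + 1) * η) = t1 at *
    generalize theta τ (x - l * η) = t2 at *
    generalize theta τ (x + l * η) = t3 at *
    generalize theta τ (x - η) = t4 at *
    generalize psi τ η l ζ s (x - η) = p1
    generalize psi τ η l ζ s (x + η) = p2
    generalize K ^ (x / η) = W at *
    field_simp
  have hne : K ^ (x / η) / (theta τ ζ * theta τ x * ∏ k ∈ Finset.Icc 1 l, theta τ (x - k * η)) ≠ 0 :=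
    div_ne_zero hW (mul_ne_zero (mul_ne_zero hζ n0) hP)
  rw [← sub_eq_zero, key, mul_eq_zero, or_iff_right hne, sub_eq_zero]

theorem hasDoubleBloch_iff {τ η : ℂ} {l : ℕ} (hτ : 0 < τ.im) (hη : η ≠ 0) {ζ K : ℂ}
    (hζ : theta τ ζ ≠ 0) (hK : K ≠ 0) (E : ℂ) : HasDoubleBloch τ η l ζ K E ↔
      ∃ s : ℕ → ℂ, (∃ j ∈ Finset.Icc 1 l, s j ≠ 0) ∧ ∀ x, BlochEqAt τ η l ζ K E s x := by
  have hθ := differentiable_theta hτ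
  refine exists_congr fun s => and_congr_right fun _ => ⟨fun h x => ?_, fun h x hx => ?_⟩
  · have hv := differentiable_psi hτ η l ζ s
    have h1 : Differentiable ℂ fun x => theta τ (x - l * η) := hθ.comp (by fun_prop)
    have h2 : Differentiable ℂ fun x => theta τ (x + l * η) := hθ.comp (by fun_prop)
    have h3 : Differentiable ℂ fun x => psi τ η l ζ s (x + η) := hv.comp (by fun_prop)
    have h4 : Differentiable ℂ fun x => psi τ η l ζ s (x - η) := hv.comp (by fun_prop)
    set F : ℂ → ℂ := fun x => K * theta τ (x - l * η) * psi τ η l ζ s (x + η)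
      + K⁻¹ * theta τ (x + l * η) * psi τ η l ζ s (x - η) - E * theta τ x * psi τ η l ζ s x with hF
    have hFd : Differentiable ℂ F := by fun_prop
    -- F is known to vanish only off the excluded translates; the factors `θ(x - jη)` are cancelled
    -- one by one by the identity theorem.
    suffices H : ∀ S : Finset ℕ, (∀ x, (∏ j ∈ S, theta τ (x - j * η)) * F x = 0) →
        ∀ x, F x = 0 by
      refine sub_eq_zero.1 (H (Finset.range (l + 2)) (fun x => ?_) x)
      by_cases hx : ∏ j ∈ Finset.range (l + 2), theta τ (x - j * η) = 0
      · rw [hx, zero_mul]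
      · have hx' := Finset.prod_ne_zero_iff.1 hx
        have := (lameEqAt_ansatz_iff hη hζ hK E s hx').1
          (h x fun j hj hL => hx' j hj ((theta_eq_zero_iff hτ).2 hL))
        have h0 : F x = 0 := sub_eq_zero.2 this
        rw [h0, mul_zero]
    intro S
    induction S using Finset.induction_on with
    | empty => simp
    | insert a S ha ih =>
      intro hS
      refine ih fun x => ?_
      refine eq_zero_of_mul_eq_zero_of_differentiable
        (F := fun x => (∏ j ∈ S, theta τ (x - j * η)) * F x) (G := fun x => theta τ (x - a * η))
        ?_ (hθ.comp (by fun_prop)) ?_ (fun x => ?_) x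
      · exact (Differentiable.fun_finsetProd fun k _ => hθ.comp (by fun_prop)).mul hFd
      · obtain ⟨y, hy⟩ := exists_theta_ne_zero hτ
        exact ⟨y + a * η, by simpa using hy⟩
      · rw [← mul_assoc, ← Finset.prod_insert ha (f := fun j : ℕ => theta τ (x - j * η))]
        exact hS x
  · refine (lameEqAt_ansatz_iff hη hζ hK E s fun j hj => ?_).2 (h x)
    rw [Ne, theta_eq_zero_iff hτ]
    exact hx j hj

/-! ### The determinant condition -/

theorem sum_Icc_eq_sum_fin (l : ℕ) (f : ℕ → ℂ) :
    ∑ k ∈ Finset.Icc 1 l, f k = ∑ a : Fin l, f (a + 1) := by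
  rw [← map_succEmb_univ, Finset.sum_map]
  rfl

/-- The matrix condition expresses the symmetry of the ansatz at the points `jη`. -/
theorem basisVal_mul_mulVec {τ η : ℂ} {l : ℕ} (hτ : 0 < τ.im)
    (hη : ∀ j : ℕ, 1 ≤ j → j ≤ 2 * l → ¬ InLattice τ (j * η)) {ζ : ℂ} (hζ : theta τ ζ ≠ 0) (K : ℂ)
    (s : ℕ → ℂ) (a : Fin l) :
    basisVal τ η l ζ (a + 1) * (multMatrix τ η l ζ K).mulVec (fun b => s (b + 1)) a
      = K ^ (2 * ((a : ℕ) + 1)) * psi τ η l ζ s (((a : ℕ) + 1 : ℕ) * η)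
        - psi τ η l ζ s (-(((a : ℕ) + 1 : ℕ) * η)) := by
  set m : ℕ := (a : ℕ) + 1 with hm
  have hml : m ∈ Finset.Icc 1 l := by
    have := a.2
    simp [hm]
  have hθ1 : theta τ η ≠ 0 := by
    have := a.2
    simpa using theta_mul_ne_zero hτ hη (j := 1) (by simp) (by omega) (by omega)
  have e1 : (multMatrix τ η l ζ K).mulVec (fun b => s (b + 1)) a
      = K ^ (2 * m) * s m + ∑ k ∈ Finset.Icc 1 l, entryG τ η l ζ m k * s k := by
    rw [sum_Icc_eq_sum_fin]
    simp only [Matrix.mulVec, dotProduct, multMatrix, Matrix.of_apply, add_mul,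
      Finset.sum_add_distrib, ite_mul, zero_mul, Finset.sum_ite_eq, Finset.mem_univ, if_true]
    rfl
  rw [e1, psi_apply_mul τ η ζ s hml, psi, mul_add, Finset.mul_sum, sub_eq_add_neg,
    ← Finset.sum_neg_distrib]
  congr 1
  · ring
  refine Finset.sum_congr rfl fun k hk => ?_
  have hG : (∏ j ∈ (Finset.Icc 1 l).erase m, enum τ η ((m : ℤ) + j) / enum τ η ((m : ℤ) - j))
      * ∏ j ∈ (Finset.Icc 1 l).erase m, theta τ (m * η - j * η)
      = ∏ j ∈ (Finset.Icc 1 l).erase m, theta τ (m * η + j * η) := by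
    rw [← Finset.prod_mul_distrib]
    refine Finset.prod_congr rfl fun j hj => ?_
    have hj' := Finset.mem_Icc.1 (Finset.mem_of_mem_erase hj)
    have := theta_sub_mul_ne_zero hτ hη (Finset.mem_Icc.1 hml).2 hj'.2
      (Finset.ne_of_mem_erase hj).symm
    rw [enum_div_enum hθ1]
    push_cast
    rw [add_mul, sub_mul, div_mul_cancel₀ _ this]
  -- The factor `θ(2mη)` is the missing j = m term, so the left side is the full product of
  -- `θ((m+j)η)`; oddness turns it into the product at -mη, with one sign per factor.
  have h2 : theta τ (2 * m * η) * ∏ j ∈ (Finset.Icc 1 l).erase m, theta τ (m * η + j * η)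
      = (-1) ^ l * (theta τ (-(m * η) - k * η)
        * ∏ j ∈ (Finset.Icc 1 l).erase k, theta τ (-(m * η) - j * η)) := by
    rw [Finset.mul_prod_erase (Finset.Icc 1 l) (fun j : ℕ => theta τ (-(m * η) - j * η)) hk,
      show 2 * (m : ℂ) * η = m * η + m * η by ring,
      Finset.mul_prod_erase (Finset.Icc 1 l) (fun j : ℕ => theta τ (m * η + j * η)) hml]
    have : ∏ _j ∈ Finset.Icc 1 l, (-1 : ℂ) = (-1) ^ l := by simp
    rw [← this, ← Finset.prod_mul_distrib]
    refine Finset.prod_congr rfl fun j _ => ?_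
    rw [show -((m : ℂ) * η) - j * η = -(m * η + j * η) by ring, theta_neg]
    ring
  have h3 : theta τ (-(m * η) - k * η) ≠ 0 := by
    have hm' := Finset.mem_Icc.1 hml
    have hk' := Finset.mem_Icc.1 hk
    have := theta_mul_ne_zero hτ hη (j := -(m + k)) (by omega) (by omega) (by omega)
    push_cast at this
    rwa [show -((m : ℂ) + k) * η = -(m * η) - k * η by ring] at this
  have hs : ((-1 : ℂ) ^ l) * (-1) ^ l = 1 := by
    rw [← mul_pow]; simp
  rw [basisVal, entryG, Phi, show -(((m : ℂ) + k) * η) = -(m * η) - k * η by ring,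
    show ζ + (-((m : ℂ) * η) - k * η) = ζ + -(m * η) - k * η by ring, pow_succ]
  generalize ∏ j ∈ (Finset.Icc 1 l).erase m, enum τ η ((m : ℤ) + j) / enum τ η ((m : ℤ) - j) = g at *
  generalize ∏ j ∈ (Finset.Icc 1 l).erase m, theta τ (m * η - j * η) = p1 at *
  generalize ∏ j ∈ (Finset.Icc 1 l).erase m, theta τ (m * η + j * η) = p2 at *
  generalize ∏ j ∈ (Finset.Icc 1 l).erase k, theta τ (-(m * η) - j * η) = p3 at *
  generalize theta τ (-(m * η) - k * η) = t1 at *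
  generalize theta τ (2 * m * η) = t2 at *
  generalize theta τ (ζ + -(m * η) - k * η) = t3 at *
  field_simp
  rw [← hG] at h2
  linear_combination (-(-1) ^ l * t3 * s k) * h2 - t3 * t1 * p3 * s k * hs

theorem mulVec_eq_zero_iff {τ η : ℂ} {l : ℕ} (hτ : 0 < τ.im)
    (hη : ∀ j : ℕ, 1 ≤ j → j ≤ 2 * l → ¬ InLattice τ (j * η)) {ζ : ℂ} (hζ : theta τ ζ ≠ 0) (K : ℂ)
    (s : ℕ → ℂ) : (multMatrix τ η l ζ K).mulVec (fun b => s (b + 1)) = 0 ↔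
      ∀ j ∈ Finset.Icc 1 l, K ^ (2 * j) * psi τ η l ζ s (j * η) = psi τ η l ζ s (-(j * η)) := by
  rw [funext_iff]
  constructor
  · intro h j hj
    have hj' := Finset.mem_Icc.1 hj
    obtain ⟨a, rfl⟩ : ∃ a : Fin l, j = a + 1 := ⟨⟨j - 1, by omega⟩, by simp only; omega⟩
    have := basisVal_mul_mulVec hτ hη hζ K s a
    rw [h a, Pi.zero_apply, mul_zero] at this
    exact sub_eq_zero.1 this.symm
  · intro h a
    have ha : (a : ℕ) + 1 ∈ Finset.Icc 1 l := by
      have := a.2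
      simp
    have := basisVal_mul_mulVec hτ hη hζ K s a
    rw [h _ ha, sub_self] at this
    exact (mul_eq_zero.1 this).resolve_left (basisVal_ne_zero hτ hη hζ ha)

/-- Multiplication by `K^{x/η}` absorbs K and K⁻¹ and gives the equation of `symm_of_diffEq`; the
values of this factor at ±jη are `K^{±j}`. -/
theorem symm_of_blochEq {τ η : ℂ} {l : ℕ} (hτ : 0 < τ.im) (hη0 : η ≠ 0)
    (hη : ∀ j : ℕ, 1 ≤ j → j ≤ 2 * l → ¬ InLattice τ (j * η)) {ζ K E : ℂ}
    (hK : K ≠ 0) {s : ℕ → ℂ} (h : ∀ x, BlochEqAt τ η l ζ K E s x) {j : ℕ} (hj : j ≤ l) :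
    K ^ (2 * j) * psi τ η l ζ s (j * η) = psi τ η l ζ s (-(j * η)) := by
  have := symm_of_diffEq hτ hη (Ψ := fun x => K ^ (x / η) * psi τ η l ζ s x) (E := E) (fun x => ?_)
    j hj
  · simp only [neg_div, mul_div_cancel_right₀ _ hη0, cpow_neg, cpow_natCast] at this
    have hKj : K ^ j ≠ 0 := pow_ne_zero _ hK
    field_simp at this
    rw [mul_comm 2 j, pow_mul]
    exact this
  · have w1 : K ^ ((x + η) / η) = K ^ (x / η) * K := by
      rw [add_div, div_self hη0, cpow_add _ _ hK, cpow_one]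
    have w2 : K ^ ((x - η) / η) = K ^ (x / η) * K⁻¹ := by
      rw [sub_div, div_self hη0, cpow_sub _ _ hK, cpow_one, div_eq_mul_inv]
    have := h x
    rw [BlochEqAt] at this
    simp only [w1, w2]
    linear_combination K ^ (x / η) * this

/-- A vector indexed by `Fin l`, as a function on `{1, …, l}` extended by zero. -/
def extendVec (l : ℕ) : (Fin l → ℂ) →ₗ[ℂ] (ℕ → ℂ) where
  toFun v j := ∑ a : Fin l, if (a : ℕ) + 1 = j then v a else 0
  map_add' v w := by
    ext j
    simp only [Pi.add_apply, ← Finset.sum_add_distrib]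
    exact Finset.sum_congr rfl fun a _ => by split_ifs <;> simp
  map_smul' c v := by
    ext j
    simp [Finset.mul_sum]

@[simp]
theorem extendVec_apply {l : ℕ} (v : Fin l → ℂ) (a : Fin l) : extendVec l v (a + 1) = v a := by
  simp [extendVec, ← Fin.ext_iff]

/-- `psi` at a point, as a linear functional of the coefficients. -/
def psiLin (τ η : ℂ) (l : ℕ) (ζ x : ℂ) : (Fin l → ℂ) →ₗ[ℂ] ℂ where
  toFun v := psi τ η l ζ (extendVec l v) x
  map_add' v w := by
    simp only [psi, map_add, Pi.add_apply, add_mul, Finset.sum_add_distrib]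
  map_smul' c v := by
    simp only [psi, map_smul, Pi.smul_apply, smul_eq_mul, RingHom.id_apply, Finset.mul_sum,
      mul_assoc]

theorem psiLin_apply (τ η : ℂ) (l : ℕ) (ζ x : ℂ) (v : Fin l → ℂ) :
    psiLin τ η l ζ x v = psi τ η l ζ (extendVec l v) x := rfl

/-- The difference operator on coefficient vectors. -/
def coeffOp (τ η : ℂ) (l : ℕ) (ζ K : ℂ) : (Fin l → ℂ) →ₗ[ℂ] (Fin l → ℂ) :=
  LinearMap.pi fun a => (theta τ (((a : ℕ) + 1 : ℕ) * η) * basisVal τ η l ζ (a + 1))⁻¹ •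
    ((K * theta τ (((a : ℕ) + 1 : ℕ) * η - l * η)) • psiLin τ η l ζ (((a : ℕ) + 1 : ℕ) * η + η)
    + (K⁻¹ * theta τ (((a : ℕ) + 1 : ℕ) * η + l * η)) •
      psiLin τ η l ζ (((a : ℕ) + 1 : ℕ) * η - η))

/-- At η, …, lη the identity holds by the choice of the coefficients. At 0 the right side vanishes,
and the left side does so by the symmetry for j = 1. -/
theorem coeffOp_spec {τ η : ℂ} {l : ℕ} (hτ : 0 < τ.im)
    (hη : ∀ j : ℕ, 1 ≤ j → j ≤ 2 * l → ¬ InLattice τ (j * η)) {ζ K : ℂ} (hζ : ¬ InLattice τ ζ)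
    (hK : K ≠ 0) {v : Fin l → ℂ} (hv : ∀ j ∈ Finset.Icc 1 l,
      K ^ (2 * j) * psi τ η l ζ (extendVec l v) (j * η) = psi τ η l ζ (extendVec l v) (-(j * η)))
    (x : ℂ) : K * theta τ (x - l * η) * psi τ η l ζ (extendVec l v) (x + η)
      + K⁻¹ * theta τ (x + l * η) * psi τ η l ζ (extendVec l v) (x - η)
      = theta τ x * psi τ η l ζ (extendVec l (coeffOp τ η l ζ K v)) x := by
  have hζ' : theta τ ζ ≠ 0 := fun h => hζ ((theta_eq_zero_iff hτ).1 h)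
  refine diffEq_of_values hτ hη hζ K _ _ (fun m hm => ?_) x
  rcases Nat.eq_zero_or_pos m with h0 | h0
  · subst h0
    rcases Nat.eq_zero_or_pos l with hl | hl
    · subst hl
      simp [psi]
    have h1 := hv 1 (by simp; omega)
    simp only [Nat.cast_zero, zero_mul, zero_sub, zero_add, theta_zero, theta_neg, Nat.cast_one,
      one_mul, mul_one] at h1 ⊢
    rw [← h1]
    field_simp
    ring
  · have hm' : m ∈ Finset.Icc 1 l := by simp at hm ⊢; omega
    have hml := Finset.mem_Icc.1 hm'
    obtain ⟨a, rfl⟩ : ∃ a : Fin l, m = a + 1 := ⟨⟨m - 1, by omega⟩, by simp only; omega⟩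
    rw [psi_apply_mul _ _ _ _ hm', extendVec_apply]
    have n1 := basisVal_ne_zero hτ hη hζ' hm'
    have n2 : theta τ (((a : ℕ) + 1 : ℕ) * η) ≠ 0 := by
      have := theta_mul_ne_zero hτ hη (j := ((a : ℕ) + 1 : ℕ)) (by omega) (by omega) (by omega)
      simpa using this
    simp only [coeffOp, LinearMap.pi_apply, LinearMap.smul_apply, LinearMap.add_apply,
      psiLin_apply, smul_eq_mul]
    generalize theta τ (((a : ℕ) + 1 : ℕ) * η) = t at *
    generalize basisVal τ η l ζ ((a : ℕ) + 1) = b at *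
    rw [show ∀ Y, t * ((t * b)⁻¹ * Y * b) = (t * b) * (t * b)⁻¹ * Y from fun Y => by ring,
      mul_inv_cancel₀ (mul_ne_zero n2 n1), one_mul]

/-- The identity `coeffOp_spec` is compared at jη and -jη: θ is odd, so symmetry of the image at j
follows from symmetry of v at j - 1 and j + 1. -/
theorem coeffOp_symm {τ η : ℂ} {l : ℕ} (hτ : 0 < τ.im)
    (hη : ∀ j : ℕ, 1 ≤ j → j ≤ 2 * l → ¬ InLattice τ (j * η)) {ζ K : ℂ} (hζ : ¬ InLattice τ ζ)
    (hK : K ≠ 0) {v : Fin l → ℂ} (hv : ∀ j ∈ Finset.Icc 1 l,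
      K ^ (2 * j) * psi τ η l ζ (extendVec l v) (j * η) = psi τ η l ζ (extendVec l v) (-(j * η))) :
    ∀ j ∈ Finset.Icc 1 l, K ^ (2 * j) * psi τ η l ζ (extendVec l (coeffOp τ η l ζ K v)) (j * η)
      = psi τ η l ζ (extendVec l (coeffOp τ η l ζ K v)) (-(j * η)) := by
  intro j hj
  have hjl := Finset.mem_Icc.1 hj
  have hv0 : ∀ i ≤ l, K ^ (2 * i) * psi τ η l ζ (extendVec l v) (i * η)
      = psi τ η l ζ (extendVec l v) (-(i * η)) := by
    intro i hi
    rcases Nat.eq_zero_or_pos i with h0 | h0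
    · subst h0
      simp
    · exact hv i (Finset.mem_Icc.2 ⟨h0, hi⟩)
  have n2 : theta τ (j * η) ≠ 0 := by
    have := theta_mul_ne_zero hτ hη (j := j) (by omega) (by omega) (by omega)
    simpa using this
  have h1 := coeffOp_spec hτ hη hζ hK hv (j * η)
  have h2 := coeffOp_spec hτ hη hζ hK hv (-(j * η))
  obtain ⟨i, rfl⟩ : ∃ i, j = i + 1 := ⟨j - 1, by omega⟩
  have h3 := hv0 i (by omega)
  -- For j = l the symmetry at l + 1 is not available, but its coefficient is `θ(0) = 0`.
  have h4 : theta τ (((i + 1 : ℕ) : ℂ) * η - l * η)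
      * (K ^ (2 * (i + 2)) * psi τ η l ζ (extendVec l v) ((i + 2 : ℕ) * η))
      = theta τ (((i + 1 : ℕ) : ℂ) * η - l * η)
        * psi τ η l ζ (extendVec l v) (-((i + 2 : ℕ) * η)) := by
    rcases Nat.lt_or_ge (i + 1) l with h | h
    · rw [hv0 (i + 2) (by omega)]
    · obtain rfl : l = i + 1 := by omega
      simp
  rw [show ((i + 1 : ℕ) : ℂ) * η + η = (i + 2 : ℕ) * η by push_cast; ring,
    show ((i + 1 : ℕ) : ℂ) * η - η = i * η by push_cast; ring] at h1
  rw [show -(((i + 1 : ℕ) : ℂ) * η) - l * η = -((i + 1 : ℕ) * η + l * η) by ring,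
    show -(((i + 1 : ℕ) : ℂ) * η) + l * η = -((i + 1 : ℕ) * η - l * η) by ring,
    show -(((i + 1 : ℕ) : ℂ) * η) - η = -((i + 2 : ℕ) * η) by push_cast; ring,
    show -(((i + 1 : ℕ) : ℂ) * η) + η = -(i * η) by push_cast; ring,
    theta_neg, theta_neg, theta_neg] at h2
  apply mul_left_cancel₀ n2
  have hKK : K * K⁻¹ = 1 := mul_inv_cancel₀ hK
  generalize psi τ η l ζ (extendVec l v) ((i + 2 : ℕ) * η) = y1 at *
  generalize psi τ η l ζ (extendVec l v) (-((i + 2 : ℕ) * η)) = y2 at *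
  generalize psi τ η l ζ (extendVec l v) (i * η) = y3 at *
  generalize psi τ η l ζ (extendVec l v) (-(i * η)) = y4 at *
  generalize theta τ (((i + 1 : ℕ) : ℂ) * η - l * η) = t1 at *
  generalize theta τ (((i + 1 : ℕ) : ℂ) * η + l * η) = t2 at *
  field_simp at h1 h2
  apply mul_left_cancel₀ hK
  linear_combination (-K ^ (2 * (i + 1))) * h1 - h2 + h4 + K ^ 2 * t2 * h3

theorem exists_blochEq_iff {τ η : ℂ} {l : ℕ} (hτ : 0 < τ.im) (hη0 : η ≠ 0)
    (hη : ∀ j : ℕ, 1 ≤ j → j ≤ 2 * l → ¬ InLattice τ (j * η)) {ζ K : ℂ} (hζ : ¬ InLattice τ ζ)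
    (hK : K ≠ 0) :
    (∃ E : ℂ, ∃ s : ℕ → ℂ, (∃ j ∈ Finset.Icc 1 l, s j ≠ 0) ∧ ∀ x, BlochEqAt τ η l ζ K E s x)
      ↔ (multMatrix τ η l ζ K).det = 0 := by
  have hζ' : theta τ ζ ≠ 0 := fun h => hζ ((theta_eq_zero_iff hτ).1 h)
  rw [← Matrix.exists_mulVec_eq_zero_iff]
  constructor
  · rintro ⟨E, s, ⟨j, hj, hsj⟩, h⟩
    refine ⟨fun b => s (b + 1), fun h0 => hsj ?_, (mulVec_eq_zero_iff hτ hη hζ' K s).2 fun j hj =>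
      symm_of_blochEq hτ hη0 hη hK h (Finset.mem_Icc.1 hj).2⟩
    have hj' := Finset.mem_Icc.1 hj
    have := congrFun h0 ⟨j - 1, by omega⟩
    simpa [Nat.sub_add_cancel hj'.1] using this
  · rintro ⟨v₀, hv₀, h0⟩
    have hext : ∀ v : Fin l → ℂ, (fun b : Fin l => extendVec l v (b + 1)) = v := fun v => by
      ext b; simp
    -- V consists of the coefficient vectors with the symmetry. The difference operator preserves
    -- it, and being nonzero and finite-dimensional over ℂ it contains an eigenvector; the
    -- eigenvalue is E.
    set V := LinearMap.ker (multMatrix τ η l ζ K).mulVecLin with hV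
    have hmem : ∀ v : Fin l → ℂ, v ∈ V ↔ ∀ j ∈ Finset.Icc 1 l, K ^ (2 * j)
        * psi τ η l ζ (extendVec l v) (j * η) = psi τ η l ζ (extendVec l v) (-(j * η)) := by
      intro v
      rw [← mulVec_eq_zero_iff hτ hη hζ' K, hext, hV, LinearMap.mem_ker, Matrix.mulVecLin_apply]
    have hT : ∀ v ∈ V, coeffOp τ η l ζ K v ∈ V := fun v hv =>
      (hmem _).2 (coeffOp_symm hτ hη hζ hK ((hmem v).1 hv))
    have : Nontrivial V := by
      refine ⟨⟨v₀, ?_⟩, 0, fun h => hv₀ ?_⟩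
      · rw [hV, LinearMap.mem_ker, Matrix.mulVecLin_apply, h0]
      · exact congrArg Subtype.val h
    obtain ⟨E, hE⟩ := Module.End.exists_eigenvalue ((coeffOp τ η l ζ K).restrict hT)
    obtain ⟨v, hv⟩ := hE.exists_hasEigenvector
    have hev : coeffOp τ η l ζ K v = E • (v : Fin l → ℂ) := congrArg Subtype.val hv.apply_eq_smul
    have hvne : (v : Fin l → ℂ) ≠ 0 := fun h => hv.2 (Subtype.ext h)
    obtain ⟨a, ha⟩ := Function.ne_iff.1 hvne
    refine ⟨E, extendVec l v, ⟨a + 1, ?_, ?_⟩, fun x => ?_⟩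
    · have := a.2
      simp
    · rw [extendVec_apply]
      exact ha
    · have := coeffOp_spec hτ hη hζ hK ((hmem v).1 v.2) x
      rw [BlochEqAt, this, hev, map_smul]
      have e := psi_smul τ η l ζ E (extendVec l v) x
      rw [show (E • extendVec l v) = fun j => E * extendVec l v j from rfl, e]
      ring

/-! ### The spectral curve -/

/-- The three-term recurrence for the determinants of the leading blocks of a tridiagonal
matrix. -/
theorem det_tridiagonal {R : Type*} [CommRing R] (M : ℕ → ℕ → R)
    (h : ∀ a b, a + 1 < b ∨ b + 1 < a → M a b = 0) (n : ℕ) :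
    (Matrix.of fun a b : Fin (n + 2) => M a b).det
      = M (n + 1) (n + 1) * (Matrix.of fun a b : Fin (n + 1) => M a b).det
        - M n (n + 1) * M (n + 1) n * (Matrix.of fun a b : Fin n => M a b).det := by
  -- After expansion along the last row, this is the minor of the entry next to the diagonal; its
  -- last column has a single nonzero entry.
  have hN : ((Matrix.of fun a b : Fin (n + 2) => M a b).submatrix Fin.castSucc
      (Fin.castSucc (Fin.last n)).succAbove).det
      = M n (n + 1) * (Matrix.of fun a b : Fin n => M a b).det := by
    rw [Matrix.det_succ_column _ (Fin.last n), Fin.sum_univ_castSucc, Finset.sum_eq_zero]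
    · have e : (((Matrix.of fun a b : Fin (n + 2) => M a b).submatrix Fin.castSucc
          (Fin.castSucc (Fin.last n)).succAbove).submatrix (Fin.last n).succAbove
            (Fin.last n).succAbove) = Matrix.of fun a b : Fin n => M a b := by
        ext a b
        simp [Fin.succAbove_of_castSucc_lt, Fin.lt_def]
      rw [e]
      simp [Fin.succAbove_of_le_castSucc, ← two_mul, pow_mul]
    · intro i _
      have : M i (n + 1) = 0 := h _ _ (Or.inl (by have := i.2; omega))
      simp [Fin.succAbove_of_le_castSucc, this]
  rw [Matrix.det_succ_row _ (Fin.last (n + 1)), Fin.sum_univ_castSucc, Fin.sum_univ_castSucc,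
    Finset.sum_eq_zero]
  · rw [Fin.succAbove_last, hN]
    have e : (Matrix.of fun a b : Fin (n + 2) => M a b).submatrix (Fin.castSucc (n := n + 1))
        (Fin.castSucc (n := n + 1)) = Matrix.of fun a b : Fin (n + 1) => M a b := rfl
    rw [e]
    simp only [Matrix.of_apply, Fin.val_last, Fin.val_castSucc]
    have s1 : (-1 : R) ^ (n + 1 + n) = -1 := by
      rw [show n + 1 + n = 2 * n + 1 by ring, pow_succ, pow_mul]; simp
    have s2 : (-1 : R) ^ (n + 1 + (n + 1)) = 1 := by
      rw [← two_mul, pow_mul]; simp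
    rw [s1, s2]
    ring
  · intro i _
    have : M (n + 1) i = 0 := h _ _ (Or.inr (by have := i.2; omega))
    simp [this]

/-! ### Elliptic numbers and the polynomials `A_j` -/

section Numbers

variable {τ η : ℂ} {l : ℕ}

theorem theta_ne_zero_of_generic (hτ : 0 < τ.im) (hl : 1 ≤ l)
    (hη : ∀ j : ℕ, 1 ≤ j → j ≤ 2 * l → ¬ InLattice τ (j * η)) : theta τ η ≠ 0 := by
  simpa using theta_mul_ne_zero hτ hη (j := 1) (by simp) (by omega) (by omega)

theorem enum_ne_zero (hτ : 0 < τ.im)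
    (hη : ∀ j : ℕ, 1 ≤ j → j ≤ 2 * l → ¬ InLattice τ (j * η)) {j : ℤ} (h0 : j ≠ 0)
    (h1 : -(2 * l) ≤ j) (h2 : j ≤ 2 * l) : enum τ η j ≠ 0 :=
  div_ne_zero (theta_mul_ne_zero hτ hη h0 h1 h2)
    (theta_ne_zero_of_generic hτ (by omega) hη)

@[simp]
theorem enum_zero (τ η : ℂ) : enum τ η 0 = 0 := by simp [enum]

theorem enum_one (h : theta τ η ≠ 0) : enum τ η 1 = 1 := by simp [enum, h]

theorem efact_succ (τ η : ℂ) (n : ℕ) : efact τ η (n + 1) = efact τ η n * enum τ η (n + 1) := by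
  rw [efact, efact, Finset.prod_Icc_succ_top (by omega)]
  push_cast
  rfl

@[simp]
theorem efact_zero (τ η : ℂ) : efact τ η 0 = 1 := by simp [efact]

theorem efact_ne_zero (hτ : 0 < τ.im)
    (hη : ∀ j : ℕ, 1 ≤ j → j ≤ 2 * l → ¬ InLattice τ (j * η)) {n : ℕ} (hn : n ≤ 2 * l) :
    efact τ η n ≠ 0 := by
  refine Finset.prod_ne_zero_iff.2 fun j hj => ?_
  rw [Finset.mem_Icc] at hj
  exact enum_ne_zero hτ hη (by omega) (by omega) (by omega)

theorem ebinom_zero (hτ : 0 < τ.im)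
    (hη : ∀ j : ℕ, 1 ≤ j → j ≤ 2 * l → ¬ InLattice τ (j * η)) {n : ℕ} (hn : n ≤ 2 * l) :
    ebinom τ η n 0 = 1 := by
  simp [ebinom, efact_ne_zero hτ hη hn]

theorem ebinom_ne_zero (hτ : 0 < τ.im)
    (hη : ∀ j : ℕ, 1 ≤ j → j ≤ 2 * l → ¬ InLattice τ (j * η)) {n s : ℕ} (hn : n ≤ 2 * l)
    (hs : s ≤ n) : ebinom τ η n s ≠ 0 :=
  div_ne_zero (efact_ne_zero hτ hη hn) (mul_ne_zero (efact_ne_zero hτ hη (hs.trans hn))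
    (efact_ne_zero hτ hη (by omega)))

theorem enum_mul_ebinom_succ (hτ : 0 < τ.im)
    (hη : ∀ j : ℕ, 1 ≤ j → j ≤ 2 * l → ¬ InLattice τ (j * η)) {n s : ℕ} (hn : n ≤ 2 * l)
    (hs : s + 1 ≤ n) :
    enum τ η (s + 1) * ebinom τ η n (s + 1) = enum τ η (n - s) * ebinom τ η n s := by
  obtain ⟨d, rfl⟩ := Nat.exists_eq_add_of_le hs
  have e1 : s + 1 + d - (s + 1) = d := by omega
  have e2 : s + 1 + d - s = d + 1 := by omega
  rw [ebinom, ebinom, e1, e2, efact_succ, efact_succ,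
    show (((s + 1 + d : ℕ) : ℤ) - s) = d + 1 by push_cast; ring]
  have n1 := efact_ne_zero hτ hη (n := s) (by omega)
  have n2 := efact_ne_zero hτ hη (n := d) (by omega)
  have n3 := enum_ne_zero hτ hη (j := s + 1) (by omega) (by omega) (by omega)
  have n4 := enum_ne_zero hτ hη (j := d + 1) (by omega) (by omega) (by omega)
  generalize enum τ η (s + 1) = t1 at *
  generalize enum τ η (d + 1) = t2 at *
  field_simp

theorem det_triMatrix_succ_succ (τ η : ℂ) (l : ℕ) (E : ℂ) (s : ℕ) :
    (triMatrix τ η l E (s + 2)).det = E * (triMatrix τ η l E (s + 1)).det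
      + enum τ η (s + 1) / enum τ η (l - s) * (enum τ η (2 * l - s) / enum τ η (l - 1 - s))
        * (triMatrix τ η l E s).det := by
  set M : ℕ → ℕ → ℂ := fun a b =>
    let i : ℤ := (a : ℤ) + 1
    let j : ℤ := (b : ℤ) + 1
    (if i = j then E else 0)
      + (if i = j - 1 then enum τ η (-i) / enum τ η (l + 1 - i) else 0)
      + (if i = j + 1 then enum τ η (2 * l + 2 - i) / enum τ η (l + 1 - i) else 0) with hM
  have h := det_tridiagonal M (fun a b hab => by
    simp only [hM]
    rw [if_neg (by omega), if_neg (by omega), if_neg (by omega)]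
    simp) s
  have m1 : M (s + 1) (s + 1) = E := by
    simp only [hM, if_true]
    rw [if_neg (by omega), if_neg (by omega)]
    simp
  have m2 : M s (s + 1) = -enum τ η (s + 1) / enum τ η (l - s) := by
    simp only [hM]
    rw [if_neg (by omega), if_pos (by omega), if_neg (by omega), enum_neg,
      show (l : ℤ) + 1 - (s + 1) = l - s by ring]
    simp
  have m3 : M (s + 1) s = enum τ η (2 * l - s) / enum τ η (l - 1 - s) := by
    simp only [hM]
    rw [if_neg (by omega), if_neg (by omega), if_pos (by omega),
      show (l : ℤ) + 1 - ((s + 1 : ℕ) + 1) = l - 1 - s by push_cast; ring,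
      show 2 * (l : ℤ) + 2 - ((s + 1 : ℕ) + 1) = 2 * l - s by push_cast; ring]
    simp
  rw [m1, m2, m3] at h
  have h' : (triMatrix τ η l E (s + 2)).det = _ := h
  rw [h']
  change _ - _ * (triMatrix τ η l E s).det = _
  change E * (triMatrix τ η l E (s + 1)).det - _ = _
  ring

theorem det_triMatrix_one (τ η : ℂ) (l : ℕ) (E : ℂ) : (triMatrix τ η l E 1).det = E := by
  simp [triMatrix]

theorem polyA_of_eq_add (τ η : ℂ) {l j s : ℕ} (h : l = j + s) (E : ℂ) : polyA τ η l j E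
    = ebinom τ η l s / ebinom τ η (2 * l) s * (triMatrix τ η l E s).det := by
  obtain rfl : s = l - j := by omega
  rfl

theorem polyA_self (hτ : 0 < τ.im) (hη : ∀ j : ℕ, 1 ≤ j → j ≤ 2 * l → ¬ InLattice τ (j * η))
    (E : ℂ) : polyA τ η l l E = 1 := by
  rw [polyA_of_eq_add τ η (show l = l + 0 from rfl), triMatrix, Matrix.det_isEmpty,
    ebinom_zero hτ hη (n := l) (by omega), ebinom_zero hτ hη (n := 2 * l) le_rfl]
  simp

/-- The quotient of binomials is the normalization that turns the recurrence of the tridiagonal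
determinants into the one satisfied by `K^i P(iη)`; compare `blochEqAt_iff_enum`. -/
theorem polyA_recurrence (hτ : 0 < τ.im)
    (hη : ∀ j : ℕ, 1 ≤ j → j ≤ 2 * l → ¬ InLattice τ (j * η)) (E : ℂ) {i : ℕ} (hi : i + 1 ≤ l) :
    enum τ η (i + 1 + l) * polyA τ η l i E = E * enum τ η (i + 1) * polyA τ η l (i + 1) E
      + enum τ η (l - (i + 1)) * polyA τ η l (i + 2) E := by
  have ratio : ∀ s, s + 1 ≤ l → enum τ η (2 * l - s) * (ebinom τ η l (s + 1)
      / ebinom τ η (2 * l) (s + 1)) = enum τ η (l - s) * (ebinom τ η l s / ebinom τ η (2 * l) s) := by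
    intro s hs
    have h1 := enum_mul_ebinom_succ hτ hη (n := l) (by omega) hs
    have h2 := enum_mul_ebinom_succ hτ hη (n := 2 * l) (s := s) le_rfl (by omega)
    push_cast at h2
    have n0 := enum_ne_zero hτ hη (j := s + 1) (by omega) (by omega) (by omega)
    have n1 := ebinom_ne_zero hτ hη (n := 2 * l) (s := s) le_rfl (by omega)
    have n2 := ebinom_ne_zero hτ hη (n := 2 * l) (s := s + 1) le_rfl (by omega)
    generalize enum τ η (s + 1) = t0 at *
    generalize enum τ η (2 * l - s) = t1 at *
    generalize enum τ η (l - s) = t2 at *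
    generalize ebinom τ η (2 * l) (s + 1) = b1 at *
    generalize ebinom τ η (2 * l) s = b2 at *
    field_simp
    apply mul_left_cancel₀ n0
    linear_combination t1 * b2 * h1 - t2 * ebinom τ η l s * h2
  obtain ⟨s, rfl⟩ := Nat.exists_eq_add_of_le hi
  have r1 := ratio s (by omega)
  rw [show ((i : ℤ) + 1 + (i + 1 + s : ℕ)) = 2 * (i + 1 + s : ℕ) - s by push_cast; ring,
    show (((i + 1 + s : ℕ) : ℤ) - (i + 1)) = s by push_cast; ring,
    show ((i : ℤ) + 1) = (i + 1 + s : ℕ) - s by push_cast; ring]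
  rw [polyA_of_eq_add τ η (j := i) (s := s + 1) (by omega), polyA_of_eq_add τ η (j := i + 1) rfl]
  match s with
  -- Here i + 1 = l, and `polyA` at l + 1 is a meaningless value; its coefficient `[0]` is zero.
  | 0 =>
    rw [det_triMatrix_one]
    simp only [Nat.cast_zero, enum_zero, zero_mul, add_zero] at r1 ⊢
    rw [triMatrix, Matrix.det_isEmpty]
    linear_combination E * r1
  | s + 1 =>
    have r2 := ratio s (by omega)
    rw [det_triMatrix_succ_succ, polyA_of_eq_add τ η (j := i + 2) (s := s) (by omega)]
    have n1 := enum_ne_zero hτ hη (j := (i + 1 + (s + 1) : ℕ) - s) (by omega) (by omega) (by omega)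
    have n2 := enum_ne_zero hτ hη (j := (i + 1 + (s + 1) : ℕ) - (s + 1 : ℕ)) (by omega) (by omega)
      (by omega)
    rw [show ((i + 1 + (s + 1) : ℕ) : ℤ) - 1 - s = (i + 1 + (s + 1) : ℕ) - (s + 1 : ℕ) by
      push_cast; ring]
    rw [show ((s + 1 : ℕ) : ℤ) = (s : ℤ) + 1 by push_cast; ring] at *
    generalize (triMatrix τ η (i + 1 + (s + 1)) E (s + 1)).det = D1 at *
    generalize (triMatrix τ η (i + 1 + (s + 1)) E s).det = D0 at *
    generalize ebinom τ η (i + 1 + (s + 1)) (s + 1 + 1) / ebinom τ η (2 * (i + 1 + (s + 1))) (s + 1 + 1)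
      = a2 at *
    generalize ebinom τ η (i + 1 + (s + 1)) (s + 1) / ebinom τ η (2 * (i + 1 + (s + 1))) (s + 1)
      = a1 at *
    generalize ebinom τ η (i + 1 + (s + 1)) s / ebinom τ η (2 * (i + 1 + (s + 1))) s = a0 at *
    generalize enum τ η ((i + 1 + (s + 1) : ℕ) - s) = t1 at *
    generalize enum τ η ((i + 1 + (s + 1) : ℕ) - (s + 1)) = t2 at *
    generalize enum τ η (s + 1) = t3 at *
    generalize enum τ η (2 * (i + 1 + (s + 1) : ℕ) - s) = t4 at *
    generalize enum τ η (2 * (i + 1 + (s + 1) : ℕ) - (s + 1)) = t5 at *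
    field_simp
    linear_combination (E * D1 * t1 * t2 + t3 * t4 * D0) * r1 + t3 * D0 * t2 * r2

/-! ### Lagrange interpolation at 0 and at -η -/

theorem prod_enum_sub (τ η : ℂ) (i d : ℕ) :
    ∏ k ∈ (Finset.Icc 1 (i + 1 + d)).erase (i + 1), enum τ η ((i + 1 : ℕ) - k)
      = (-1) ^ d * (efact τ η i * efact τ η d) := by
  induction d with
  | zero =>
    have : (Finset.Icc 1 (i + 1 + 0)).erase (i + 1) = Finset.Icc 1 i := by
      ext k
      simp only [Finset.mem_erase, Finset.mem_Icc]
      omega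
    rw [this, efact, prod_Icc_eq_prod_range, prod_Icc_eq_prod_range, efact_zero, pow_zero, one_mul,
      mul_one, ← Finset.prod_range_reflect]
    refine Finset.prod_congr rfl fun k hk => ?_
    congr 1
    have := Finset.mem_range.1 hk
    omega
  | succ d ih =>
    have : (Finset.Icc 1 (i + 1 + (d + 1))).erase (i + 1)
        = insert (i + 1 + d + 1) ((Finset.Icc 1 (i + 1 + d)).erase (i + 1)) := by
      ext k
      simp only [Finset.mem_erase, Finset.mem_Icc, Finset.mem_insert]
      omega
    rw [this, Finset.prod_insert (by simp), ih, efact_succ,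
      show ((i + 1 : ℕ) : ℤ) - (i + 1 + d + 1 : ℕ) = -(d + 1) by push_cast; ring, enum_neg]
    ring

theorem prod_enum_neg (τ η : ℂ) (l : ℕ) :
    ∏ k ∈ Finset.Icc 1 l, enum τ η (-k) = (-1) ^ l * efact τ η l := by
  simp only [enum_neg, Finset.prod_neg, Nat.card_Icc, add_tsub_cancel_right, efact]

theorem prod_enum_neg_succ (h : theta τ η ≠ 0) (l : ℕ) :
    ∏ k ∈ Finset.Icc 1 l, enum τ η (-1 - k) = (-1) ^ l * efact τ η (l + 1) := by
  have : ∀ k : ℕ, enum τ η (-1 - k) = -enum τ η (k + 1) := fun k => by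
    rw [← enum_neg]; congr 1; ring
  simp only [this, Finset.prod_neg, Nat.card_Icc, add_tsub_cancel_right]
  congr 1
  have h2 := prod_range_succ_eq_mul_Icc l (fun k => enum τ η (k + 1))
  simp only [Nat.cast_zero, zero_add, enum_one h, one_mul] at h2
  rw [← h2, efact, prod_Icc_eq_prod_range]
  simp

theorem prod_theta_eq (h : theta τ η ≠ 0) (S : Finset ℕ) (f : ℕ → ℤ) :
    ∏ k ∈ S, theta τ (f k * η) = theta τ η ^ S.card * ∏ k ∈ S, enum τ η (f k) := by
  rw [← Finset.prod_const, ← Finset.prod_mul_distrib]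
  exact Finset.prod_congr rfl fun k _ => by rw [enum, mul_div_cancel₀ _ h]

/-- This compares the products in the j-th interpolant at 0 and at jη; the quotient explains the
binomial in the first curve equation. -/
theorem prod_theta_neg (hτ : 0 < τ.im)
    (hη : ∀ j : ℕ, 1 ≤ j → j ≤ 2 * l → ¬ InLattice τ (j * η)) {j : ℕ} (hj : j ∈ Finset.Icc 1 l) :
    ∏ k ∈ (Finset.Icc 1 l).erase j, theta τ (0 - k * η) = -(-1) ^ j * ebinom τ η l j
      * ∏ k ∈ (Finset.Icc 1 l).erase j, theta τ (j * η - k * η) := by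
  have hj' := Finset.mem_Icc.1 hj
  have ht := theta_ne_zero_of_generic hτ (hj'.1.trans hj'.2) hη
  have e1 := prod_theta_eq ht ((Finset.Icc 1 l).erase j) (fun k => -k)
  have e2 := prod_theta_eq ht ((Finset.Icc 1 l).erase j) (fun k => j - k)
  have e3 := Finset.mul_prod_erase (Finset.Icc 1 l) (fun k : ℕ => enum τ η (-k)) hj
  rw [prod_enum_neg, enum_neg] at e3
  simp only [Int.cast_neg, Int.cast_natCast, neg_mul, Int.cast_sub, sub_mul] at e1 e2
  simp only [zero_sub]
  rw [e1, e2]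
  obtain ⟨i, rfl⟩ : ∃ i, j = i + 1 := ⟨j - 1, by omega⟩
  obtain ⟨d, rfl⟩ := Nat.exists_eq_add_of_le hj'.2
  rw [prod_enum_sub, ebinom, efact_succ, show i + 1 + d - (i + 1) = d by omega]
  have n1 := efact_ne_zero hτ hη (n := i) (by omega)
  have n2 := efact_ne_zero hτ hη (n := d) (by omega)
  have n3 := enum_ne_zero hτ hη (j := i + 1) (by omega) (by omega) (by omega)
  push_cast at e3
  have hs : ((-1 : ℂ) ^ d) * (-1) ^ d = 1 := by rw [← mul_pow]; simp
  generalize ∏ k ∈ (Finset.Icc 1 (i + 1 + d)).erase (i + 1), enum τ η (-k) = X at *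
  generalize enum τ η (i + 1) = t at *
  field_simp
  rw [pow_add] at e3
  linear_combination -e3

/-- The analogue at -η: the quotient produces the coefficient with index j + 1 in the second curve
equation. -/
theorem prod_theta_neg_succ (hτ : 0 < τ.im)
    (hη : ∀ j : ℕ, 1 ≤ j → j ≤ 2 * l → ¬ InLattice τ (j * η)) {j : ℕ} (hj : j ∈ Finset.Icc 1 l) :
    ∏ k ∈ (Finset.Icc 1 l).erase j, theta τ (-η - k * η)
      = -(-1) ^ j * enum τ η j * ebinom τ η (l + 1) (j + 1)
      * ∏ k ∈ (Finset.Icc 1 l).erase j, theta τ (j * η - k * η) := by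
  have hj' := Finset.mem_Icc.1 hj
  have ht := theta_ne_zero_of_generic hτ (hj'.1.trans hj'.2) hη
  have e1 := prod_theta_eq ht ((Finset.Icc 1 l).erase j) (fun k => -1 - k)
  have e2 := prod_theta_eq ht ((Finset.Icc 1 l).erase j) (fun k => j - k)
  have e3 := Finset.mul_prod_erase (Finset.Icc 1 l) (fun k : ℕ => enum τ η (-1 - k)) hj
  rw [prod_enum_neg_succ ht, show (-1 : ℤ) - j = -(j + 1) by ring, enum_neg] at e3
  simp only [Int.cast_neg, Int.cast_one, Int.cast_natCast, neg_mul, one_mul, Int.cast_sub,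
    sub_mul] at e1 e2
  rw [e1, e2]
  obtain ⟨i, rfl⟩ : ∃ i, j = i + 1 := ⟨j - 1, by omega⟩
  obtain ⟨d, rfl⟩ := Nat.exists_eq_add_of_le hj'.2
  rw [prod_enum_sub, ebinom, efact_succ _ _ (i + 1), efact_succ _ _ i,
    show i + 1 + d + 1 - (i + 1 + 1) = d by omega]
  have n1 := efact_ne_zero hτ hη (n := i) (by omega)
  have n2 := efact_ne_zero hτ hη (n := d) (by omega)
  have n3 := enum_ne_zero hτ hη (j := i + 1) (by omega) (by omega) (by omega)
  have n4 := enum_ne_zero hτ hη (j := i + 1 + 1) (by omega) (by omega) (by omega)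
  push_cast at e3 ⊢
  have hs : ((-1 : ℂ) ^ d) * (-1) ^ d = 1 := by rw [← mul_pow]; simp
  generalize ∏ k ∈ (Finset.Icc 1 (i + 1 + d)).erase (i + 1), enum τ η (-1 - k) = X at *
  generalize enum τ η (i + 1 + 1) = t' at *
  generalize enum τ η (i + 1) = t at *
  field_simp
  rw [pow_add] at e3
  linear_combination -e3

/-- The first equation of the spectral curve is the interpolation identity at `0`. -/
theorem curve_fst (hτ : 0 < τ.im) (hη : ∀ j : ℕ, 1 ≤ j → j ≤ 2 * l → ¬ InLattice τ (j * η))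
    {ζ K E κ : ℂ} {s : ℕ → ℂ} (hs : ∀ j ∈ Finset.Icc 1 l,
      s j * basisVal τ η l ζ j = κ * K⁻¹ ^ j * polyA τ η l j E) :
    κ * (∑ j ∈ Finset.range (l + 1), (-1) ^ j * K⁻¹ ^ j * theta τ (ζ - j * η)
        * ebinom τ η l j * polyA τ η l j E)
      = theta τ ζ * (κ * polyA τ η l 0 E - psi τ η l ζ s 0) := by
  have e : theta τ ζ * psi τ η l ζ s 0 = -∑ j ∈ Finset.Icc 1 l, κ * ((-1) ^ j * K⁻¹ ^ j
      * theta τ (ζ - j * η) * ebinom τ η l j * polyA τ η l j E) := by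
    rw [psi, Finset.mul_sum, ← Finset.sum_neg_distrib]
    refine Finset.sum_congr rfl fun j hj => ?_
    have h := hs j hj
    rw [basisVal] at h
    rw [prod_theta_neg hτ hη hj, add_zero]
    linear_combination (-(-1) ^ j * ebinom τ η l j * theta τ (ζ - j * η)) * h
  rw [mul_sub, e, Finset.sum_range_succ', ← Finset.mul_sum]
  have h2 : ∑ j ∈ Finset.Icc 1 l, ((-1) ^ j * K⁻¹ ^ j
      * theta τ (ζ - j * η) * ebinom τ η l j * polyA τ η l j E) = ∑ j ∈ Finset.range l,
      ((-1) ^ (j + 1) * K⁻¹ ^ (j + 1) * theta τ (ζ - (j + 1 : ℕ) * η) * ebinom τ η l (j + 1)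
        * polyA τ η l (j + 1) E) := by
    rw [sum_Icc_eq_sum_fin, Finset.sum_range]
  rw [h2, ebinom_zero hτ hη (by omega)]
  simp
  ring

/-- The second equation of the spectral curve is the interpolation identity at `-η`. -/
theorem curve_snd (hτ : 0 < τ.im) (hl : 1 ≤ l)
    (hη : ∀ j : ℕ, 1 ≤ j → j ≤ 2 * l → ¬ InLattice τ (j * η))
    {ζ K E κ : ℂ} (hK : K ≠ 0) {s : ℕ → ℂ} (hs : ∀ j ∈ Finset.Icc 1 l,
      s j * basisVal τ η l ζ j = κ * K⁻¹ ^ j * polyA τ η l j E) :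
    κ * K * (∑ j ∈ Finset.range (l + 2), (-1) ^ j * K⁻¹ ^ j * theta τ (ζ - j * η)
        * enum τ η ((j : ℤ) - 1) * ebinom τ η (l + 1) j
        * polyA τ η l ((j : ℤ) - 1).natAbs E)
      = theta τ ζ * (psi τ η l ζ s (-η) - κ * K * polyA τ η l 1 E) := by
  have ht := theta_ne_zero_of_generic hτ hl hη
  set f : ℕ → ℂ := fun j => (-1) ^ j * K⁻¹ ^ j * theta τ (ζ - j * η)
        * enum τ η ((j : ℤ) - 1) * ebinom τ η (l + 1) j
        * polyA τ η l ((j : ℤ) - 1).natAbs E with hf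
  have e : theta τ ζ * psi τ η l ζ s (-η) = ∑ j ∈ Finset.Icc 1 l, κ * K * f (j + 1) := by
    rw [psi, Finset.mul_sum]
    refine Finset.sum_congr rfl fun j hj => ?_
    have h := hs j hj
    rw [basisVal] at h
    have e1 : ((j + 1 : ℕ) : ℤ) - 1 = j := by push_cast; ring
    simp only [hf]
    rw [prod_theta_neg_succ hτ hη hj, e1, Int.natAbs_natCast,
      show ζ + -η - j * η = ζ - (j + 1 : ℕ) * η by push_cast; ring, pow_succ (K⁻¹)]
    have hKK : K * K⁻¹ = 1 := mul_inv_cancel₀ hK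
    linear_combination (-(-1) ^ j * enum τ η j * ebinom τ η (l + 1) (j + 1)
      * theta τ (ζ - (j + 1 : ℕ) * η)) * h + κ * (-1) ^ j * K⁻¹ ^ j
      * theta τ (ζ - (j + 1 : ℕ) * η) * enum τ η j * ebinom τ η (l + 1) (j + 1)
      * polyA τ η l j E * hKK
  -- The term with index 0 carries `[-1] = -1` and `A_{|-1|} = A_1`; it accounts for the value at η.
  -- The term with index 1 vanishes because of `[0]`.
  have f0 : f 0 = -theta τ ζ * polyA τ η l 1 E := by
    simp only [hf]
    rw [ebinom_zero hτ hη (by omega)]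
    simp [enum_neg, enum_one ht]
  have f1 : f 1 = 0 := by simp [hf]
  have h2 : ∑ j ∈ Finset.Icc 1 l, f (j + 1) = ∑ j ∈ Finset.range l, f (j + 1 + 1) := by
    rw [sum_Icc_eq_sum_fin, Finset.sum_range]
  change κ * K * ∑ j ∈ Finset.range (l + 2), f j = _
  rw [mul_sub, e, Finset.sum_range_succ', Finset.sum_range_succ', f0, zero_add, f1, ← Finset.mul_sum,
    h2]
  ring

/-- In terms of the weighted values `K^i P(iη)` the powers of K disappear, leaving the recurrence of
`polyA_recurrence`. -/
theorem blochEqAt_iff_enum (ht : theta τ η ≠ 0) {ζ K E : ℂ} (hK : K ≠ 0) (s : ℕ → ℂ) (i : ℕ) :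
    BlochEqAt τ η l ζ K E s ((i + 1 : ℕ) * η) ↔
      enum τ η (i + 1 + l) * (K ^ i * psi τ η l ζ s (i * η))
        = E * enum τ η (i + 1) * (K ^ (i + 1) * psi τ η l ζ s ((i + 1 : ℕ) * η))
          + enum τ η (l - (i + 1)) * (K ^ (i + 2) * psi τ η l ζ s ((i + 2 : ℕ) * η)) := by
  have h1 : theta τ (((i + 1 : ℕ) : ℂ) * η - l * η) = -(theta τ η * enum τ η (l - (i + 1))) := by
    rw [enum, mul_div_cancel₀ _ ht, ← theta_neg]
    congr 1
    push_cast
    ring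
  have h2 : theta τ (((i + 1 : ℕ) : ℂ) * η + l * η) = theta τ η * enum τ η (i + 1 + l) := by
    rw [enum, mul_div_cancel₀ _ ht]
    congr 1
    push_cast
    ring
  have h3 : theta τ (((i + 1 : ℕ) : ℂ) * η) = theta τ η * enum τ η (i + 1) := by
    rw [enum, mul_div_cancel₀ _ ht]
    congr 1
  have hne : theta τ η * K ^ (i + 1) ≠ 0 := mul_ne_zero ht (pow_ne_zero _ hK)
  rw [BlochEqAt, h1, h2, h3, show ((i + 1 : ℕ) : ℂ) * η + η = (i + 2 : ℕ) * η by push_cast; ring,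
    show ((i + 1 : ℕ) : ℂ) * η - η = i * η by push_cast; ring, ← sub_eq_zero, ← mul_eq_zero_iff_left
      (pow_ne_zero (i + 1) hK)]
  have hKK : K * K⁻¹ = 1 := mul_inv_cancel₀ hK
  constructor
  · intro h
    apply mul_left_cancel₀ ht
    linear_combination h - K ^ i * theta τ η * enum τ η (i + 1 + l) * psi τ η l ζ s (i * η) * hKK
  · intro h
    linear_combination theta τ η * h
      + K ^ i * theta τ η * enum τ η (i + 1 + l) * psi τ η l ζ s (i * η) * hKK

theorem blochEqAt_zero_iff (hτ : 0 < τ.im) (hl : 1 ≤ l)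
    (hη : ∀ j : ℕ, 1 ≤ j → j ≤ 2 * l → ¬ InLattice τ (j * η)) {ζ K E : ℂ} (hK : K ≠ 0)
    (s : ℕ → ℂ) : BlochEqAt τ η l ζ K E s 0 ↔
      psi τ η l ζ s (-η) = K * (K * psi τ η l ζ s η) := by
  have h := theta_mul_ne_zero hτ hη (j := l) (by omega) (by omega) (by omega)
  simp only [Int.cast_natCast] at h
  simp only [BlochEqAt, zero_sub, zero_add, theta_neg, theta_zero, mul_zero, zero_mul]
  constructor
  · intro e
    apply mul_left_cancel₀ h
    field_simp at e
    linear_combination e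
  · intro e
    rw [e]
    field_simp
    ring

/-- The recurrence forces `K^i P(iη) = κ A_i(E)` for 0 ≤ i ≤ l. Interpolation from η, …, lη must
reproduce this at i = 0 and the value `K² P(η)` at -η; these two requirements are the curve
equations. -/
theorem exists_blochEq_iff_curve (hτ : 0 < τ.im) (hl : 1 ≤ l)
    (hη : ∀ j : ℕ, 1 ≤ j → j ≤ 2 * l → ¬ InLattice τ (j * η)) {ζ K : ℂ} (hζ : ¬ InLattice τ ζ)
    (hK : K ≠ 0) (E : ℂ) :
    (∃ s : ℕ → ℂ, (∃ j ∈ Finset.Icc 1 l, s j ≠ 0) ∧ ∀ x, BlochEqAt τ η l ζ K E s x)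
      ↔ (ζ, K, E) ∈ spectralCurve τ η l := by
  have hζ' : theta τ ζ ≠ 0 := fun h => hζ ((theta_eq_zero_iff hτ).1 h)
  have ht := theta_ne_zero_of_generic hτ hl hη
  constructor
  · rintro ⟨s, ⟨j, hj, hsj⟩, h⟩
    set κ := K ^ l * psi τ η l ζ s (l * η) with hκ
    -- The recursion runs downwards from i = l. It can be solved for the lower value because
    -- `[i+1+l] ≠ 0`, the index being at most 2l.
    have hw : ∀ d i : ℕ, i + d = l → K ^ i * psi τ η l ζ s (i * η) = κ * polyA τ η l i E := by
      intro d
      induction d using Nat.strong_induction_on with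
      | _ d ih =>
        intro i hid
        match d with
        | 0 =>
          obtain rfl : i = l := hid
          rw [polyA_self hτ hη, mul_one]
        | e + 1 =>
          have h1 := ih e (by omega) (i + 1) (by omega)
          have h2 : enum τ η (l - (i + 1)) * (K ^ (i + 2) * psi τ η l ζ s ((i + 2 : ℕ) * η))
              = enum τ η (l - (i + 1)) * (κ * polyA τ η l (i + 2) E) := by
            -- When i + 1 = l the value of `psi` at (l+1)η is uncontrolled, but it is multiplied by
            -- `[0]`.
            match e with
            | 0 =>
              rw [show (l : ℤ) - (i + 1) = 0 by omega, enum_zero, zero_mul, zero_mul]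
            | e + 1 => rw [ih e (by omega) (i + 2) (by omega)]
          have h3 := (blochEqAt_iff_enum ht hK s i).1 (h _)
          rw [h1, h2] at h3
          have h4 := polyA_recurrence hτ hη E (i := i) (by omega)
          have hne := enum_ne_zero hτ hη (j := i + 1 + l) (by omega) (by omega) (by omega)
          apply mul_left_cancel₀ hne
          linear_combination h3 - κ * h4
    have hs : ∀ j ∈ Finset.Icc 1 l,
        s j * basisVal τ η l ζ j = κ * K⁻¹ ^ j * polyA τ η l j E := by
      intro j hj
      have := hw (l - j) j (by have := Finset.mem_Icc.1 hj; omega)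
      rw [psi_apply_mul τ η ζ s hj] at this
      apply mul_left_cancel₀ (pow_ne_zero j hK)
      rw [this, inv_pow]
      field_simp
    have hκ0 : κ ≠ 0 := by
      intro h0
      have := hs j hj
      rw [h0, zero_mul, zero_mul] at this
      exact hsj ((mul_eq_zero.1 this).resolve_right (basisVal_ne_zero hτ hη hζ' hj))
    refine ⟨hζ, hK, ?_, ?_⟩
    · have h0 := hw l 0 (by omega)
      simp only [pow_zero, one_mul, Nat.cast_zero, zero_mul] at h0
      have := curve_fst hτ hη hs
      rw [h0, sub_self, mul_zero] at this
      exact (mul_eq_zero.1 this).resolve_left hκ0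
    · have h1 := hw (l - 1) 1 (by omega)
      simp only [pow_one, Nat.cast_one, one_mul] at h1
      have h2 := (blochEqAt_zero_iff hτ hl hη hK s).1 (h 0)
      have := curve_snd hτ hl hη hK hs
      rw [h2, h1, show K * (κ * polyA τ η l 1 E) - κ * K * polyA τ η l 1 E = 0 by ring,
        mul_zero] at this
      exact (mul_eq_zero.1 this).resolve_left (mul_ne_zero hκ0 hK)
  · rintro ⟨-, -, h1, h2⟩
    -- These coefficients give `P(jη) = K^{-j} A_j(E)`, the solution of the recurrence normalized by
    -- κ = 1. It is nontrivial because `A_l = 1`.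
    set s : ℕ → ℂ := fun j => K⁻¹ ^ j * polyA τ η l j E / basisVal τ η l ζ j with hsdef
    have hs : ∀ j ∈ Finset.Icc 1 l,
        s j * basisVal τ η l ζ j = 1 * K⁻¹ ^ j * polyA τ η l j E := by
      intro j hj
      rw [hsdef, one_mul]
      exact div_mul_cancel₀ _ (basisVal_ne_zero hτ hη hζ' hj)
    have c1 := curve_fst hτ hη hs
    have c2 := curve_snd hτ hl hη hK hs
    simp only at h1 h2
    rw [h1, mul_zero, eq_comm, mul_eq_zero, or_iff_right hζ', sub_eq_zero] at c1
    rw [h2, mul_zero, eq_comm, mul_eq_zero, or_iff_right hζ', sub_eq_zero] at c2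
    have hw : ∀ i ≤ l, K ^ i * psi τ η l ζ s (i * η) = polyA τ η l i E := by
      intro i hi
      rcases Nat.eq_zero_or_pos i with h0 | h0
      · subst h0
        simp [← c1]
      · have hi' : i ∈ Finset.Icc 1 l := Finset.mem_Icc.2 ⟨h0, hi⟩
        rw [psi_apply_mul τ η ζ s hi', hs i hi', inv_pow]
        field_simp
    refine ⟨s, ⟨l, by simp [hl], ?_⟩, blochEqAt_of_values hτ hη hζ fun m hm => ?_⟩
    · rw [hsdef]
      simp only [polyA_self hτ hη]
      exact div_ne_zero (by simp [hK]) (basisVal_ne_zero hτ hη hζ' (by simp [hl]))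
    · match m with
      | 0 =>
        rw [Nat.cast_zero, zero_mul, blochEqAt_zero_iff hτ hl hη hK, c2, one_mul]
        have := hw 1 hl
        simp only [pow_one, Nat.cast_one, one_mul] at this
        rw [this]
      | i + 1 =>
        have hi : i + 1 ≤ l := by simp at hm; omega
        rw [blochEqAt_iff_enum ht hK, hw i (by omega), hw (i + 1) hi, polyA_recurrence hτ hη E hi]
        congr 1
        rcases Nat.lt_or_ge (i + 1) l with h | h
        · rw [hw (i + 2) (by omega)]
        · rw [show (l : ℤ) - (i + 1) = 0 by omega, enum_zero, zero_mul, zero_mul]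

end Numbers

end DiffLame

end

theorem mainTheorem3 (τ η : ℂ) (l : ℕ) (hτ : 0 < τ.im) (hl : 1 ≤ l)
    (hη : ∀ j : ℕ, 1 ≤ j → j ≤ 2 * l → ¬ DiffLame.InLattice τ (j * η)) :
    -- entire solutions of the gauge-equivalent equation are symmetric at the points `jη`
    (∀ (E : ℂ) (Ψ : ℂ → ℂ), Differentiable ℂ Ψ →
      (∀ x : ℂ, ¬ DiffLame.InLattice τ x →
        DiffLame.theta τ (x - l * η) / DiffLame.theta τ x * Ψ (x + η)
          + DiffLame.theta τ (x + l * η) / DiffLame.theta τ x * Ψ (x - η) = E * Ψ x) →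
      ∀ j : ℕ, 1 ≤ j → j ≤ l → Ψ (j * η) = Ψ (-(j * η))) ∧
    -- the projection of the spectral curve to the `(ζ, K)` plane
    ((fun p : ℂ × ℂ × ℂ => (p.1, p.2.1)) '' DiffLame.spectralCurve τ η l
      = {q : ℂ × ℂ | ¬ DiffLame.InLattice τ q.1 ∧ q.2 ≠ 0 ∧
          (DiffLame.multMatrix τ η l q.1 q.2).det = 0}) ∧
    -- the same set in terms of the parameters of double-Bloch solutions
    (∀ ζ K : ℂ, ¬ DiffLame.InLattice τ ζ → K ≠ 0 →
      ((∃ E : ℂ, DiffLame.HasDoubleBloch τ η l ζ K E) ↔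
        (DiffLame.multMatrix τ η l ζ K).det = 0)) ∧
    -- the expanded form of the relation
    (∀ ζ K : ℂ, ¬ DiffLame.InLattice τ ζ →
      DiffLame.theta τ ζ * (DiffLame.multMatrix τ η l ζ K).det
          = DiffLame.relationSum τ η l ζ K ∧
      ((DiffLame.multMatrix τ η l ζ K).det = 0 ↔ DiffLame.relationSum τ η l ζ K = 0)) ∧
    -- the coefficients
    DiffLame.coeffC τ η l 0 = 1 ∧
    (∀ j : ℕ, j ≤ DiffLame.bigN l →
      DiffLame.coeffC τ η l j = DiffLame.coeffC τ η l (DiffLame.bigN l - j)) := by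
  have hη0 : η ≠ 0 := by
    rintro rfl
    exact hη 1 le_rfl (by omega) ⟨0, 0, by simp⟩
  have hθ0 : ∀ {ζ : ℂ}, ¬ DiffLame.InLattice τ ζ → DiffLame.theta τ ζ ≠ 0 := fun hζ h =>
    hζ ((DiffLame.theta_eq_zero_iff hτ).1 h)
  -- Solvability of the cleared equation is the link: with E fixed it describes the curve, with E
  -- existentially quantified it describes the determinant.
  have hcurve : ∀ {ζ K : ℂ}, ¬ DiffLame.InLattice τ ζ → K ≠ 0 →
      ((∃ E, (ζ, K, E) ∈ DiffLame.spectralCurve τ η l) ↔ (DiffLame.multMatrix τ η l ζ K).det = 0) := fun hζ hK => by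
    rw [← DiffLame.exists_blochEq_iff hτ hη0 hη hζ hK]
    exact exists_congr fun E => (DiffLame.exists_blochEq_iff_curve hτ hl hη hζ hK E).symm
  refine ⟨?_, ?_, ?_, ?_, DiffLame.coeffC_zero τ η l, fun j hj => DiffLame.coeffC_symm τ η hj⟩
  · intro E Ψ hΨ h j _ hj
    exact DiffLame.symm_of_diffEq hτ hη (DiffLame.diffEq_of_off_lattice hτ hΨ h) j hj
  · ext ⟨ζ, K⟩
    constructor
    · rintro ⟨⟨ζ', K', E⟩, hp, hq⟩
      obtain ⟨rfl, rfl⟩ := Prod.mk.inj hq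
      exact ⟨hp.1, hp.2.1, (hcurve hp.1 hp.2.1).1 ⟨E, hp⟩⟩
    · rintro ⟨hζ, hK, hdet⟩
      obtain ⟨E, hE⟩ := (hcurve hζ hK).2 hdet
      exact ⟨(ζ, K, E), hE, rfl⟩
  · intro ζ K hζ hK
    rw [← DiffLame.exists_blochEq_iff hτ hη0 hη hζ hK]
    exact exists_congr fun E => DiffLame.hasDoubleBloch_iff hτ hη0 (hθ0 hζ) hK E
  · intro ζ K hζ
    have h := DiffLame.theta_mul_det_multMatrix hτ hη (hθ0 hζ) K
    refine ⟨h, ?_⟩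
    rw [← h, mul_eq_zero, or_iff_right (hθ0 hζ)]
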